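/- A \emph{C*-category} is a unital category whose arrow spaces $(\sigma,\tau)$ are complex Banach spaces, with bilinear composition satisfying $\|t'\circ t\|\le\|t'\|\,\|t\|$, and with an antilinear isometric involutive contravariant functor $*$, equal to the identity on objects, such that $\|t^*\circ t\|=\|t\|^2$. A \emph{symmetric tensor C*-category} $(\mathcal T,\otimes,\iota,\varepsilon)$ is a C*-category with a strictly associative and strictly unital bilinear $*$-bifunctor $\otimes$ with unit object $\iota$, and a natural unitary symmetry $\varepsilon(\sigma,\tau)\in(\sigma\tau,\tau\sigma)$, where $\sigma\tau:=\sigma\otimes\tau$, satisfying $\varepsilon(\tau,\sigma)\circ\varepsilon(\sigma,\tau)=1_{\sigma\tau}$, $\varepsilon(\sigma,\iota)=1_\sigma$ and $\varepsilon(\sigma\tau,\upsilon)=(\varepsilon(\sigma,\upsilon)\otimes1_\tau)\circ(1_\sigma\otimes\varepsilon(\tau,\upsilon))$. Let $C(X^\iota)$ be the commutative C*-algebra of those $f\in(\iota,\iota)$ with $f\otimes 1_\sigma=1_\sigma\otimes f$ for all objects $\sigma$, and $X^\iota$ its (compact) Gelfand spectrum. For closed $W\subseteq X^\iota$, the restriction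 $\mathcal T_W$ has the same objects as $\mathcal T$ and arrow spaces $(\sigma,\tau)/\mathrm{span}\{f\otimes t: t\in(\sigma,\tau),\ f\in C(X^\iota),\ f|_W=0\}$. For an object $\rho$ and $r\in\mathbb N$ let $\varepsilon_\rho$ be the unitary representation of the symmetric group $\mathbb P_r$ in $(\rho^r,\rho^r)$ that $\varepsilon$ induces, and let $P_{\rho,\varepsilon,r}=\frac1{r!}\sum_{p\in\mathbb P_r}\mathrm{sign}(p)\,\varepsilon_\rho(p)$ be the antisymmetric projection. The object $\rho$ is \emph{special} if there are an integer $d\ge1$ and $V\in(\iota,\rho^d)$ with $V^*\circ V=1_\iota$, $V\circ V^*=P_{\rho,\varepsilon,d}$ and $(V^*\otimes1_\rho)\circ(1_\rho\otimes V)=(-1)^{d-1}d^{-1}1_\rho$. A triple $(\rho,d,\mathcal V)$, with $d\ge1$ an integer and $\mathcal V\subseteq(\iota,\rho^d)$ a closed subspace, is a \emph{twisted special object} if for all $V,V'\in\mathcal V$ and $f\in(\iota,\iota)$ $$f\otimes V=V\otimes f\in\mathcal V,\qquad (V^*\otimes1_\rho)\circ(1_\rho\otimes V')=(-1)^{d-1}d^{-1}(V^*\circ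 V')\otimes1_\rho,$$ $$\mathrm{span}\{V'\circ V^*:V,V'\in\mathcal V\}=\{f\otimes P_{\rho,\varepsilon,d}:f\in(\iota,\iota)\}.$$ The object $\rho$ has \emph{dimension} $d\in\mathbb N$ if it has a conjugate in the closure for subobjects with $R^*\circ R=d\,1_\iota$, that is, if there are an object $\sigma$, a projection $E=E^*=E\circ E\in(\sigma,\sigma)$ and an arrow $R\in(\iota,\sigma\rho)$ with $(E\otimes1_\rho)\circ R=R$ such that, putting $\overline R:=\varepsilon(\sigma,\rho)\circ R$, one has $(\overline R^*\otimes1_\rho)\circ(1_\rho\otimes R)=1_\rho$, $(R^*\otimes E)\circ(E\otimes\overline R)=E$ and $R^*\circ R=d\,1_\iota$. A \emph{special category} $\widehat\rho$ with fibre $\widehat\rho_\bullet$ is a symmetric tensor C*-category $\widehat\rho$ whose objects are the tensor powers $\rho^r$, $r\in\mathbb N$, of an object $\rho$, together with a symmetric tensor C*-category $\widehat\rho_\bullet$ with $(\iota_\bullet,\iota_\bullet)\simeq\mathbb C$, such that every $x\in X^\iota$ has a closed neighbourhood $W$ with a $C(W)$-linear isomorphism from $\widehat\rho_W$ onto the constant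 bundle $W\widehat\rho_\bullet$ (whose arrows are the continuous maps from $W$ to the arrow spaces of $\widehat\rho_\bullet$) that preserves composition, identities, involution, tensor product and symmetry, these isomorphisms inducing one and the same bijection on objects, and such that the object $\rho_\bullet$ corresponding to $\rho$ is a special object of $\widehat\rho_\bullet$. \textbf{Proposition.} Let $\widehat\rho$ be a special category with fibre $\widehat\rho_\bullet$. Then $\rho_\bullet$ has a dimension $d\in\mathbb N$; and if $d$ is the dimension of $\rho_\bullet$ and $\mathcal V:=\{V\in(\iota,\rho^d): V=P_{\rho,\varepsilon,d}\circ V\}$, then $(\rho,d,\mathcal V)$ is a twisted special object. -/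

import Mathlib

open scoped Topology

universe u v w

/-- Transport of an arrow along equalities of its source and of its target. -/
def homCast {O : Type u} (H : O → O → Type v) {a a' b b' : O} (ha : a = a') (hb : b = b')
    (t : H a b) : H a' b' :=
  cast (congrArg₂ H ha hb) t

/-- A unital C*-category with collection of objects `O`: Banach spaces of arrows, bilinear
submultiplicative composition (`comp t' t` is `t'` after `t`), identity arrows, and an antilinear
isometric involutive cofunctor `adj` which fixes the objects and satisfies the C*-identity. -/
structure CStarCategory (O : Type u) where
  Hom : O → O → Type v
  instNormed : ∀ a b, NormedAddCommGroup (Hom a b)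
  instSpace : ∀ a b, NormedSpace ℂ (Hom a b)
  instComplete : ∀ a b, CompleteSpace (Hom a b)
  id : ∀ a, Hom a a
  comp : ∀ {a b c}, Hom b c →ₗ[ℂ] Hom a b →ₗ[ℂ] Hom a c
  adj : ∀ {a b}, Hom a b →ₗ⋆[ℂ] Hom b a
  id_comp : ∀ {a b} (t : Hom a b), comp (id b) t = t
  comp_id : ∀ {a b} (t : Hom a b), comp t (id a) = t
  assoc : ∀ {a b c e} (r : Hom c e) (s : Hom b c) (t : Hom a b),
    comp (comp r s) t = comp r (comp s t)
  norm_comp_le : ∀ {a b c} (s : Hom b c) (t : Hom a b), ‖comp s t‖ ≤ ‖s‖ * ‖t‖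
  adj_adj : ∀ {a b} (t : Hom a b), adj (adj t) = t
  adj_comp : ∀ {a b c} (s : Hom b c) (t : Hom a b), adj (comp s t) = comp (adj t) (adj s)
  norm_adj : ∀ {a b} (t : Hom a b), ‖adj t‖ = ‖t‖
  norm_adj_comp_self : ∀ {a b} (t : Hom a b), ‖comp (adj t) t‖ = ‖t‖ ^ 2

attribute [instance] CStarCategory.instNormed CStarCategory.instSpace
  CStarCategory.instComplete

/-- A (strict) tensor C*-category. The tensor product of objects is the monoid operation of `O`,
written additively: `ρ + σ` is `ρ ⊗ σ`, the unit object `ι` is `0`, and `r • ρ` is `ρ ^ r`. -/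
structure TensorCStarCategory (O : Type u) [AddMonoid O] extends CStarCategory.{u, v} O where
  tensor : ∀ {a b c e}, Hom a b →ₗ[ℂ] Hom c e →ₗ[ℂ] Hom (a + c) (b + e)
  tensor_id : ∀ a c, tensor (id a) (id c) = id (a + c)
  tensor_comp : ∀ {a b c a' b' c'} (s : Hom b c) (t : Hom a b) (s' : Hom b' c') (t' : Hom a' b'),
    tensor (comp s t) (comp s' t') = comp (tensor s s') (tensor t t')
  tensor_adj : ∀ {a b c e} (s : Hom a b) (t : Hom c e), adj (tensor s t) = tensor (adj s) (adj t)
  tensor_assoc : ∀ {a b c a' b' c'} (r : Hom a a') (s : Hom b b') (t : Hom c c'),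
    homCast Hom (add_assoc a b c) (add_assoc a' b' c') (tensor (tensor r s) t) =
      tensor r (tensor s t)
  unit_tensor : ∀ {a b} (t : Hom a b),
    homCast Hom (zero_add a) (zero_add b) (tensor (id 0) t) = t
  tensor_unit : ∀ {a b} (t : Hom a b),
    homCast Hom (add_zero a) (add_zero b) (tensor t (id 0)) = t

/-- A symmetric tensor C*-category: `symm ρ σ` is the unitary `ε(ρ, σ) ∈ (ρ σ, σ ρ)`. -/
structure SymmetricTensorCStarCategory (O : Type u) [AddMonoid O] extends
    TensorCStarCategory.{u, v} O where
  symm : ∀ a b, Hom (a + b) (b + a)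
  symm_natural : ∀ {a b a' b'} (t : Hom a b) (t' : Hom a' b'),
    comp (symm b b') (tensor t t') = comp (tensor t' t) (symm a a')
  symm_symm : ∀ a b, comp (symm b a) (symm a b) = id (a + b)
  adj_symm : ∀ a b, adj (symm a b) = symm b a
  symm_unit : ∀ a, homCast Hom (add_zero a) (zero_add a) (symm a 0) = id a
  symm_hexagon : ∀ a b c, symm (a + b) c =
    comp (homCast Hom (add_assoc a c b) (add_assoc c a b) (tensor (symm a c) (id b)))
      (homCast Hom (add_assoc a b c).symm rfl (tensor (id a) (symm b c)))

namespace CStarCategory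

variable {O : Type u} (T : CStarCategory.{u, v} O)

/-- The endomorphisms of an object form a unital C*-algebra. -/
noncomputable instance instNormedRing (a : O) : NormedRing (T.Hom a a) where
  __ := T.instNormed a a
  mul s t := T.comp s t
  one := T.id a
  mul_assoc := T.assoc
  one_mul := T.id_comp
  mul_one := T.comp_id
  left_distrib r s t := (T.comp r).map_add s t
  right_distrib r s t := by
    change T.comp (r + s) t = _
    rw [map_add]; rfl
  zero_mul t := by
    change T.comp 0 t = 0
    rw [map_zero]; rfl
  mul_zero t := (T.comp t).map_zero
  norm_mul_le := T.norm_comp_le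
  dist_eq := (T.instNormed a a).dist_eq

lemma mul_def {a : O} (s t : T.Hom a a) : s * t = T.comp s t := rfl

lemma one_def (a : O) : (1 : T.Hom a a) = T.id a := rfl

noncomputable instance instStarRing (a : O) : StarRing (T.Hom a a) where
  star t := T.adj t
  star_involutive := T.adj_adj
  star_mul := T.adj_comp
  star_add s t := T.adj.map_add s t

lemma star_def {a : O} (t : T.Hom a a) : star t = T.adj t := rfl

noncomputable instance instNormedAlgebra (a : O) : NormedAlgebra ℂ (T.Hom a a) where
  __ := T.instSpace a a
  __ := Algebra.ofModule (R := ℂ) (A := T.Hom a a)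
    (fun r s t => by rw [T.mul_def, map_smul]; rfl)
    (fun r s t => (T.comp s).map_smul r t)

noncomputable instance instCStarAlgebra (a : O) : CStarAlgebra (T.Hom a a) where
  __ := T.instNormedRing a
  __ := T.instStarRing a
  __ := T.instNormedAlgebra a
  complete := (T.instComplete a a).complete
  norm_mul_self_le t := by
    rw [T.mul_def, T.star_def, T.norm_adj_comp_self, sq]
  star_smul c t := T.adj.map_smulₛₗ c t

/-- The object `a` is simple: its endomorphisms are the scalars, `(a, a) ≃ ℂ`. -/
def IsSimple (a : O) : Prop := Function.Bijective (algebraMap ℂ (T.Hom a a))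

lemma homCast_comp {a a' b b' c c' : O} (ha : a = a') (hb : b = b') (hc : c = c')
    (s : T.Hom b c) (t : T.Hom a b) :
    homCast T.Hom ha hc (T.comp s t) = T.comp (homCast T.Hom hb hc s) (homCast T.Hom ha hb t) := by
  subst ha hb hc; rfl

lemma homCast_add {a a' b b' : O} (ha : a = a') (hb : b = b') (s t : T.Hom a b) :
    homCast T.Hom ha hb (s + t) = homCast T.Hom ha hb s + homCast T.Hom ha hb t := by
  subst ha hb; rfl

lemma homCast_smul {a a' b b' : O} (ha : a = a') (hb : b = b') (c : ℂ) (t : T.Hom a b) :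
    homCast T.Hom ha hb (c • t) = c • homCast T.Hom ha hb t := by
  subst ha hb; rfl

lemma homCast_adj {a a' b b' : O} (ha : a = a') (hb : b = b') (t : T.Hom a b) :
    homCast T.Hom hb ha (T.adj t) = T.adj (homCast T.Hom ha hb t) := by
  subst ha hb; rfl

end CStarCategory

namespace TensorCStarCategory

variable {O : Type u} [AddMonoid O] (T : TensorCStarCategory.{u, v} O)

/-- `f ⊗ t ∈ (σ, τ)` for `f ∈ (ι, ι)` and `t ∈ (σ, τ)`. -/
def unitTensor {a b : O} (f : T.Hom 0 0) (t : T.Hom a b) : T.Hom a b :=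
  homCast T.Hom (zero_add a) (zero_add b) (T.tensor f t)

/-- `t ⊗ f ∈ (σ, τ)` for `f ∈ (ι, ι)` and `t ∈ (σ, τ)`. -/
def tensorUnit {a b : O} (t : T.Hom a b) (f : T.Hom 0 0) : T.Hom a b :=
  homCast T.Hom (add_zero a) (add_zero b) (T.tensor t f)

/-- The C*-algebra of all `f ∈ (ι, ι)` such that `f ⊗ 1_ρ = 1_ρ ⊗ f` for all objects `ρ`. -/
noncomputable def baseAlgebra : StarSubalgebra ℂ (T.Hom 0 0) where
  carrier := {f | ∀ a, T.unitTensor f (T.id a) = T.tensorUnit (T.id a) f}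
  mul_mem' := by
    intro f g hf hg a
    have h1 : T.unitTensor (f * g) (T.id a) =
        T.comp (T.unitTensor f (T.id a)) (T.unitTensor g (T.id a)) := by
      rw [unitTensor, unitTensor, unitTensor, ← T.homCast_comp, ← T.tensor_comp, T.id_comp]; rfl
    have h2 : T.tensorUnit (T.id a) (f * g) =
        T.comp (T.tensorUnit (T.id a) f) (T.tensorUnit (T.id a) g) := by
      rw [tensorUnit, tensorUnit, tensorUnit, ← T.homCast_comp, ← T.tensor_comp, T.id_comp]; rfl
    rw [h1, h2, hf a, hg a]
  add_mem' := by
    intro f g hf hg a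
    have h1 : T.unitTensor (f + g) (T.id a) =
        T.unitTensor f (T.id a) + T.unitTensor g (T.id a) := by
      rw [unitTensor, map_add, LinearMap.add_apply, T.homCast_add]; rfl
    have h2 : T.tensorUnit (T.id a) (f + g) =
        T.tensorUnit (T.id a) f + T.tensorUnit (T.id a) g := by
      rw [tensorUnit, map_add, T.homCast_add]; rfl
    rw [h1, h2, hf a, hg a]
  algebraMap_mem' := by
    intro c a
    rw [Algebra.algebraMap_eq_smul_one, unitTensor, tensorUnit, map_smul, map_smul,
      LinearMap.smul_apply, T.homCast_smul, T.homCast_smul, T.one_def, T.unit_tensor, T.tensor_unit]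
  star_mem' := by
    intro f hf a
    have hid : T.adj (T.id a) = T.id a := star_one (T.Hom a a)
    have h1 : T.unitTensor (star f) (T.id a) = T.adj (T.unitTensor f (T.id a)) := by
      rw [unitTensor, unitTensor, ← T.homCast_adj, T.tensor_adj, hid]; rfl
    have h2 : T.tensorUnit (T.id a) (star f) = T.adj (T.tensorUnit (T.id a) f) := by
      rw [tensorUnit, tensorUnit, ← T.homCast_adj, T.tensor_adj, hid]; rfl
    rw [h1, h2, hf a]

/-- The space `X^ι`: the Gelfand spectrum of `baseAlgebra`, so that `baseAlgebra` is `C(X^ι)` and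
the value of `f` at the point `x` is `x f`. -/
abbrev BaseSpace : Type v := WeakDual.characterSpace ℂ T.baseAlgebra

/-- The subspace `C_{X∖W}(X) (σ, τ)` of `(σ, τ)`: the linear span of all `f ⊗ t` with
`f ∈ C(X^ι)` vanishing on `W`. -/
def vanishing (W : Set T.BaseSpace) (a b : O) : Submodule ℂ (T.Hom a b) :=
  Submodule.span ℂ {s | ∃ (f : T.baseAlgebra) (t : T.Hom a b),
    (∀ x ∈ W, x f = 0) ∧ s = T.unitTensor (f : T.Hom 0 0) t}

/-- The arrow spaces `(σ, τ)_W = (σ, τ) / C_{X∖W}(X) (σ, τ)` of the restriction `T_W`. All the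
operations of `T_W` are defined on representatives. -/
abbrev RestrictedHom (W : Set T.BaseSpace) (a b : O) : Type v := T.Hom a b ⧸ T.vanishing W a b

/-- The restriction epifunctor `η_W : T → T_W`. -/
def restrict (W : Set T.BaseSpace) {a b : O} : T.Hom a b →ₗ[ℂ] T.RestrictedHom W a b :=
  (T.vanishing W a b).mkQ

end TensorCStarCategory

namespace SymmetricTensorCStarCategory

variable {O : Type u} [AddMonoid O] (T : SymmetricTensorCStarCategory.{u, v} O)

lemma cycle_source (ρ : O) (n : ℕ) (k : Fin (n + 1)) :
    ρ + (k : ℕ) • ρ + (n - k : ℕ) • ρ = (n + 1) • ρ := by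
  rw [← succ_nsmul', ← add_nsmul]; congr 1; omega

lemma cycle_target (ρ : O) (n : ℕ) (k : Fin (n + 1)) :
    (k : ℕ) • ρ + ρ + (n - k : ℕ) • ρ = (n + 1) • ρ := by
  rw [← succ_nsmul, ← add_nsmul]; congr 1; omega

/-- `ε(ρ, ρ^k) ⊗ 1_{ρ^(n-k)} ∈ (ρ^(n+1), ρ^(n+1))`: it moves the tensor factor in position `0` to
position `k`, and the factors in the positions `1, …, k` one step to the left. -/
def cycleArrow (ρ : O) (n : ℕ) (k : Fin (n + 1)) : T.Hom ((n + 1) • ρ) ((n + 1) • ρ) :=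
  homCast T.Hom (cycle_source ρ n k) (cycle_target ρ n k)
    (T.tensor (T.symm ρ ((k : ℕ) • ρ)) (T.id ((n - k : ℕ) • ρ)))

/-- The representation `ε_ρ` of the permutations of `r` objects by unitaries of `(ρ^r, ρ^r)`, which
moves the tensor factor in position `i` to position `p i`. A permutation `p` of `0, …, n` is the
product of the cycle `0 ↦ k, 1 ↦ 0, …, k ↦ k - 1`, where `k = p 0`, and of a permutation that
fixes `0`. -/
def permArrow (ρ : O) : ∀ r : ℕ, Equiv.Perm (Fin r) → T.Hom (r • ρ) (r • ρ)
  | 0, _ => T.id (0 • ρ)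
  | n + 1, p =>
    T.comp (T.cycleArrow ρ n (p 0))
      (homCast T.Hom (succ_nsmul' ρ n).symm (succ_nsmul' ρ n).symm
        (T.tensor (T.id ρ)
          (permArrow ρ n (Equiv.Perm.decomposeFin (Fin.cycleRange (p 0) * p)).2)))

/-- The antisymmetric projection `P_{ρ,ε,r} = (1/r!) ∑ sign(p) ε_ρ(p)`. -/
noncomputable def antisym (ρ : O) (r : ℕ) : T.Hom (r • ρ) (r • ρ) :=
  ((r.factorial : ℂ)⁻¹) •
    ∑ p : Equiv.Perm (Fin r), ((Equiv.Perm.sign p : ℤ) : ℂ) • T.permArrow ρ r p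

/-- The space of all `V ∈ (ι, ρ^d)` with `V = P_{ρ,ε,d} ∘ V`. -/
noncomputable def antisymmetricArrows (ρ : O) (d : ℕ) : Submodule ℂ (T.Hom 0 (d • ρ)) :=
  LinearMap.eqLocus LinearMap.id (T.comp (T.antisym ρ d))

/-- `(V^* ⊗ 1_ρ) ∘ (1_ρ ⊗ V') ∈ (ρ, ρ)` for `V, V' ∈ (ι, ρ^d)`. -/
def contract {ρ : O} {d : ℕ} (V V' : T.Hom 0 (d • ρ)) : T.Hom ρ ρ :=
  T.comp
    (homCast T.Hom (succ_nsmul ρ d).symm (zero_add ρ) (T.tensor (T.adj V) (T.id ρ)))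
    (homCast T.Hom (add_zero ρ) (succ_nsmul' ρ d).symm (T.tensor (T.id ρ) V'))

/-- `(ρ, d, V)` is a special object. -/
structure IsSpecialObject (ρ : O) (d : ℕ) (V : T.Hom 0 (d • ρ)) : Prop where
  pos : 0 < d
  adj_comp_self : T.comp (T.adj V) V = T.id 0
  comp_adj_self : T.comp V (T.adj V) = T.antisym ρ d
  contract_self : T.contract V V = ((-1 : ℂ) ^ (d - 1) * (d : ℂ)⁻¹) • T.id ρ

/-- `(ρ, d, 𝒱)` is a twisted special object. -/
structure IsTwistedSpecialObject (ρ : O) (d : ℕ) (𝒱 : Submodule ℂ (T.Hom 0 (d • ρ))) : Prop where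
  pos : 0 < d
  isClosed : IsClosed (𝒱 : Set (T.Hom 0 (d • ρ)))
  unitTensor_eq : ∀ V ∈ 𝒱, ∀ f : T.Hom 0 0, T.unitTensor f V = T.tensorUnit V f
  unitTensor_mem : ∀ V ∈ 𝒱, ∀ f : T.Hom 0 0, T.unitTensor f V ∈ 𝒱
  contract_eq : ∀ V ∈ 𝒱, ∀ V' ∈ 𝒱, T.contract V V' =
    ((-1 : ℂ) ^ (d - 1) * (d : ℂ)⁻¹) • T.unitTensor (T.comp (T.adj V) V') (T.id ρ)
  span_eq :
    (Submodule.span ℂ {s | ∃ V ∈ 𝒱, ∃ V' ∈ 𝒱, s = T.comp V' (T.adj V)} :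
      Set (T.Hom (d • ρ) (d • ρ))) =
    Set.range fun f : T.Hom 0 0 => T.unitTensor f (T.antisym ρ d)

/-- The object `ρ` has dimension `d`: it has a conjugate in the closure for subobjects, that is, a
projection `E ∈ (σ, σ)` with `R ∈ (ι, E ⊗ ρ)` and `R' = ε(σ, ρ) ∘ R ∈ (ι, ρ ⊗ E)`, such that the
conjugate equations `(R'^* ⊗ 1_ρ) ∘ (1_ρ ⊗ R) = 1_ρ` and `(R^* ⊗ 1_E) ∘ (1_E ⊗ R') = 1_E` hold
(where `1_E = E`), and `R^* ∘ R = d`. -/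
def HasDimension (ρ : O) (d : ℕ) : Prop :=
  ∃ (σ : O) (E : T.Hom σ σ) (R : T.Hom 0 (σ + ρ)) (R' : T.Hom 0 (ρ + σ)),
    T.adj E = E ∧ T.comp E E = E ∧
    T.comp (T.tensor E (T.id ρ)) R = R ∧
    R' = T.comp (T.symm σ ρ) R ∧
    T.comp (homCast T.Hom (add_assoc ρ σ ρ) (zero_add ρ) (T.tensor (T.adj R') (T.id ρ)))
      (homCast T.Hom (add_zero ρ) rfl (T.tensor (T.id ρ) R)) = T.id ρ ∧
    T.comp (homCast T.Hom (add_assoc σ ρ σ) (zero_add σ) (T.tensor (T.adj R) E))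
      (homCast T.Hom (add_zero σ) rfl (T.tensor E R')) = E ∧
    T.comp (T.adj R) R = (d : ℂ) • T.id 0

/-- A local chart over `W`: a `C(W)`-linear isomorphism from the restriction `T_W` onto the constant
bundle `W F`, whose arrows are the continuous maps from `W` to the arrow spaces of `F`, preserving
composition, identities, involution, tensor product and symmetry. The objects of `T` and of the
fibre `F` are identified by the bijection that the charts induce. A bijective linear functor that
preserves the involution is isometric. -/
structure LocalChart (T : SymmetricTensorCStarCategory.{u, v} O)
    (F : SymmetricTensorCStarCategory.{u, w} O) (W : Set T.BaseSpace) where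
  map : ∀ {a b : O}, T.RestrictedHom W a b ≃ₗ[ℂ] C(W, F.Hom a b)
  map_id : ∀ (a : O) (x : W), map (T.restrict W (T.id a)) x = F.id a
  map_comp : ∀ {a b c : O} (s : T.Hom b c) (t : T.Hom a b) (x : W),
    map (T.restrict W (T.comp s t)) x =
      F.comp (map (T.restrict W s) x) (map (T.restrict W t) x)
  map_adj : ∀ {a b : O} (t : T.Hom a b) (x : W),
    map (T.restrict W (T.adj t)) x = F.adj (map (T.restrict W t) x)
  map_base : ∀ {a b : O} (f : T.baseAlgebra) (t : T.Hom a b) (x : W),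
    map (T.restrict W (T.unitTensor (f : T.Hom 0 0) t)) x =
      (x : T.BaseSpace) f • map (T.restrict W t) x
  map_tensor : ∀ {a b c e : O} (s : T.Hom a b) (t : T.Hom c e) (x : W),
    map (T.restrict W (T.tensor s t)) x =
      F.tensor (map (T.restrict W s) x) (map (T.restrict W t) x)
  map_symm : ∀ (a b : O) (x : W), map (T.restrict W (T.symm a b)) x = F.symm a b

/-- `T` is locally trivial with fibre `F`, where `F` has a simple identity object. -/
def IsLocallyTrivial (T : SymmetricTensorCStarCategory.{u, v} O)
    (F : SymmetricTensorCStarCategory.{u, w} O) : Prop :=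
  F.IsSimple 0 ∧
    ∀ x : T.BaseSpace, ∃ W ∈ 𝓝 x, IsClosed W ∧ Nonempty (LocalChart T F W)

/-- `T` is a special category with generating object `ρ` and fibre `F`: its objects are the tensor
powers of `ρ`, it is locally trivial with fibre `F`, and the object of `F` corresponding to `ρ` is
a special object. -/
structure IsSpecialCategory (T : SymmetricTensorCStarCategory.{u, v} O)
    (F : SymmetricTensorCStarCategory.{u, w} O) (ρ : O) : Prop where
  generates : ∀ σ : O, ∃ r : ℕ, r • ρ = σ
  locallyTrivial : IsLocallyTrivial T F
  special : ∃ (d : ℕ) (V : F.Hom 0 (d • ρ)), F.IsSpecialObject ρ d V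

end SymmetricTensorCStarCategory

/-! The argument has a fibre half, which identifies the dimension, and a local-to-global half.

In the fibre, let `V` make `ρ` special with integer `d`. Cyclic permutations act on `V` by their
signs, so with `R = √d V` in `(ι, ρ^(d-1) ρ)` the arrow `ε ∘ R` is `R` up to the sign `(-1)^(d-1)`.
This sign cancels the one in the definition of a special object: `R` solves the first conjugate
equation, and `R^* ∘ R = d` (`IsSpecialObject.hasDimension`). The projection `E` that cuts the
conjugate out of `ρ^(d-1)` is built from `R` alone. Given solutions `R`, `S` of the first equation,
the same construction gives `X` with `(X ⊗ 1) ∘ R = S` and `(X^* ⊗ 1) ∘ S = R`, whence `R^* ∘ R =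
S^* ∘ S`. As `(ι, ι)` of the fibre is `ℂ`, the dimension is unique, so it is the integer of the
special object.

Globally, naturality of the symmetry puts every `f ∈ (ι, ι)` into `C(X^ι)`. An identity of arrows
can be checked in charts (`IsLocallyTrivial.eq_of_eval_eq`), where an antisymmetric `V` takes values
`z • V₀` and the relations reduce to those of `V₀`. For the span condition, the `f` with `f ⊗ P` in
the span form an ideal. Lifting `V₀` through a chart and multiplying by a bump function shows that
this ideal has no common zero, so it is everything. The ideal argument replaces a partition of unity
and gives the algebraic span, without closure. -/

namespace CStarCategory

/-! ### Arrows with variable source and target, as a calculus without transports. -/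

variable {O : Type u} (T : CStarCategory.{u, v} O)

/-- The arrows of `T` with their sources and targets. Equations between arrows whose sources and
targets agree only propositionally are equations in this type. -/
structure Arr where
  dom : O
  cod : O
  hom : T.Hom dom cod

variable {T}

/-- The arrow `t` as an element of the collection of all arrows. -/
def arr {a b : O} (t : T.Hom a b) : T.Arr := ⟨a, b, t⟩

@[simp] lemma arr_dom {a b : O} (t : T.Hom a b) : (arr t).dom = a := rfl

@[simp] lemma arr_cod {a b : O} (t : T.Hom a b) : (arr t).cod = b := rfl

lemma arr_injective {a b : O} {s t : T.Hom a b} (h : arr s = arr t) : s = t := by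
  unfold arr at h
  injection h

-- Transports disappear here, so strict associativity and units become equations in a monoid.
@[simp] lemma arr_homCast {a b a' b' : O} (ha : a = a') (hb : b = b') (t : T.Hom a b) :
    arr (homCast T.Hom ha hb t) = arr t := by
  subst ha hb; rfl

lemma exists_arr_eq (s : T.Arr) {a b : O} (ha : s.dom = a) (hb : s.cod = b) :
    ∃ t : T.Hom a b, arr t = s := by
  subst ha hb; exact ⟨s.hom, rfl⟩

namespace Arr

open Classical in
/-- Composition of arrows, with value zero if the arrows are not composable. -/
noncomputable def comp (s t : T.Arr) : T.Arr :=
  if h : t.cod = s.dom then ⟨t.dom, s.cod, T.comp s.hom (homCast T.Hom rfl h t.hom)⟩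
  else ⟨t.dom, s.cod, 0⟩

/-- The adjoint of an arrow. -/
def adj (s : T.Arr) : T.Arr := ⟨s.cod, s.dom, T.adj s.hom⟩

@[simp] lemma comp_dom (s t : T.Arr) : (s.comp t).dom = t.dom := by
  unfold comp; split <;> rfl

@[simp] lemma comp_cod (s t : T.Arr) : (s.comp t).cod = s.cod := by
  unfold comp; split <;> rfl

@[simp] lemma adj_dom (s : T.Arr) : s.adj.dom = s.cod := rfl

@[simp] lemma adj_cod (s : T.Arr) : s.adj.cod = s.dom := rfl

@[simp] lemma adj_adj (s : T.Arr) : s.adj.adj = s := by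
  obtain ⟨a, b, s⟩ := s
  change Arr.mk a b (T.adj (T.adj s)) = _
  rw [T.adj_adj]

end Arr

@[simp] lemma arr_comp {a b c : O} (s : T.Hom b c) (t : T.Hom a b) :
    arr (T.comp s t) = (arr s).comp (arr t) := by
  unfold Arr.comp
  rw [dif_pos (show (arr t).cod = (arr s).dom from rfl)]
  rfl

@[simp] lemma arr_adj {a b : O} (t : T.Hom a b) : arr (T.adj t) = (arr t).adj := rfl

namespace Arr

lemma comp_of_ne {s t : T.Arr} (h : t.cod ≠ s.dom) : s.comp t = arr (0 : T.Hom t.dom s.cod) := by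
  unfold comp; rw [dif_neg h]; rfl

lemma comp_zero (s : T.Arr) (a b : O) :
    s.comp (arr (0 : T.Hom a b)) = arr (0 : T.Hom a s.cod) := by
  by_cases h : b = s.dom
  · obtain ⟨b', c, s⟩ := s
    dsimp only at h
    subst h
    change (arr s).comp (arr _) = _
    rw [← arr_comp, map_zero]
  · exact comp_of_ne h

lemma zero_comp (t : T.Arr) (b c : O) :
    (arr (0 : T.Hom b c)).comp t = arr (0 : T.Hom t.dom c) := by
  by_cases h : t.cod = b
  · obtain ⟨a, b', t⟩ := t
    dsimp only at h
    subst h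
    change (arr _).comp (arr t) = _
    rw [← arr_comp, map_zero]
    rfl
  · exact comp_of_ne h

/-- Associativity needs no composability hypothesis: if either junction fails, both sides are the
zero arrow with the same source and target. -/
lemma comp_assoc (r s t : T.Arr) : (r.comp s).comp t = r.comp (s.comp t) := by
  by_cases h : t.cod = s.dom
  · by_cases h' : s.cod = r.dom
    · obtain ⟨a, b, t⟩ := t
      obtain ⟨b', c, s⟩ := s
      obtain ⟨c', e, r⟩ := r
      dsimp only at h h'
      subst h h'
      change ((arr r).comp (arr s)).comp (arr t) = (arr r).comp ((arr s).comp (arr t))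
      rw [← arr_comp, ← arr_comp, ← arr_comp, ← arr_comp, T.assoc]
    · rw [comp_of_ne h', comp_of_ne (s := r) (t := s.comp t) (by simpa using h'), zero_comp,
        comp_dom]
  · rw [comp_of_ne h, comp_of_ne (s := r.comp s) (t := t) (by simpa using h), comp_zero, comp_cod]

lemma id_comp {a : O} {t : T.Arr} (h : t.cod = a) : (arr (T.id a)).comp t = t := by
  subst h
  obtain ⟨a, b, t⟩ := t
  change (arr _).comp (arr t) = arr t
  rw [← arr_comp]
  exact congrArg arr (T.id_comp t)

lemma comp_id {a : O} {t : T.Arr} (h : t.dom = a) : t.comp (arr (T.id a)) = t := by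
  subst h
  obtain ⟨a, b, t⟩ := t
  change (arr t).comp (arr _) = arr t
  rw [← arr_comp]
  exact congrArg arr (T.comp_id t)

lemma adj_comp (s t : T.Arr) : (s.comp t).adj = t.adj.comp s.adj := by
  by_cases h : t.cod = s.dom
  · obtain ⟨a, b, t⟩ := t
    obtain ⟨b', c, s⟩ := s
    dsimp only at h
    subst h
    change ((arr s).comp (arr t)).adj = (arr t).adj.comp (arr s).adj
    rw [← arr_comp, ← arr_adj, ← arr_adj, ← arr_adj, ← arr_comp, T.adj_comp]
  · rw [comp_of_ne h, comp_of_ne (by simpa using Ne.symm h), ← arr_adj, map_zero]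
    rfl

lemma adj_id (a : O) : (arr (T.id a)).adj = arr (T.id a) :=
  congrArg arr (star_one (T.Hom a a))

end Arr

end CStarCategory

namespace TensorCStarCategory

open CStarCategory

variable {O : Type u} [AddMonoid O] {T : TensorCStarCategory.{u, v} O}

/-- All arrows of a strict tensor category form a monoid under the tensor product. -/
instance instMonoidArr : Monoid T.Arr where
  mul s t := ⟨s.dom + t.dom, s.cod + t.cod, T.tensor s.hom t.hom⟩
  one := arr (T.id 0)
  mul_assoc r s t := by
    change arr (T.tensor (T.tensor r.hom s.hom) t.hom) = arr (T.tensor r.hom (T.tensor s.hom t.hom))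
    rw [← T.tensor_assoc, arr_homCast]
  one_mul t := by
    change arr (T.tensor (T.id 0) t.hom) = arr t.hom
    conv_rhs => rw [← T.unit_tensor t.hom, arr_homCast]
  mul_one t := by
    change arr (T.tensor t.hom (T.id 0)) = arr t.hom
    conv_rhs => rw [← T.tensor_unit t.hom, arr_homCast]

@[simp] lemma arr_tensor {a b c e : O} (s : T.Hom a b) (t : T.Hom c e) :
    arr (T.tensor s t) = arr s * arr t := rfl

@[simp] lemma arr_id_zero : arr (T.id 0) = 1 := rfl

@[simp] lemma mul_dom (s t : T.Arr) : (s * t).dom = s.dom + t.dom := rfl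

@[simp] lemma mul_cod (s t : T.Arr) : (s * t).cod = s.cod + t.cod := rfl

@[simp] lemma one_dom : (1 : T.Arr).dom = 0 := rfl

@[simp] lemma one_cod : (1 : T.Arr).cod = 0 := rfl

lemma arr_id_add (a b : O) : arr (T.id (a + b)) = arr (T.id a) * arr (T.id b) := by
  rw [← arr_tensor, T.tensor_id]

lemma mul_adj (s t : T.Arr) : (s * t).adj = s.adj * t.adj := by
  change arr (T.adj (T.tensor s.hom t.hom)) = _
  rw [T.tensor_adj]; rfl

/-- The interchange law. -/
lemma comp_mul_comp {s t s' t' : T.Arr} (h : t.cod = s.dom) (h' : t'.cod = s'.dom) :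
    s.comp t * s'.comp t' = (s * s').comp (t * t') := by
  obtain ⟨a, b, t⟩ := t
  obtain ⟨b', c, s⟩ := s
  obtain ⟨e, f, t'⟩ := t'
  obtain ⟨f', g, s'⟩ := s'
  dsimp only at h h'
  subst h h'
  change (arr s).comp (arr t) * (arr s').comp (arr t') = (arr s * arr s').comp (arr t * arr t')
  rw [← arr_comp, ← arr_comp, ← arr_tensor, ← arr_tensor, ← arr_tensor, ← arr_comp, T.tensor_comp]

/-- Together with `mul_eq_comp_right` this lets two tensor factors slide past each other. If an end
of one factor is `ι`, the corresponding identity drops out. -/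
lemma mul_eq_comp_left {s t : T.Arr} {a b : O} (ha : s.dom = a) (hb : t.cod = b) :
    s * t = (s * arr (T.id b)).comp (arr (T.id a) * t) := by
  rw [← comp_mul_comp (by simp [ha]) (by simp [hb]), Arr.comp_id ha, Arr.id_comp hb]

lemma mul_eq_comp_right {s t : T.Arr} {a b : O} (ha : s.cod = a) (hb : t.dom = b) :
    s * t = (arr (T.id a) * t).comp (s * arr (T.id b)) := by
  rw [← comp_mul_comp (by simp [ha]) (by simp [hb]), Arr.comp_id hb, Arr.id_comp ha]

@[simp] lemma arr_unitTensor {a b : O} (f : T.Hom 0 0) (t : T.Hom a b) :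
    arr (T.unitTensor f t) = arr f * arr t := by
  simp [unitTensor]

@[simp] lemma arr_tensorUnit {a b : O} (f : T.Hom 0 0) (t : T.Hom a b) :
    arr (T.tensorUnit t f) = arr t * arr f := by
  simp [tensorUnit]

end TensorCStarCategory

namespace SymmetricTensorCStarCategory

open CStarCategory TensorCStarCategory

variable {O : Type u} [AddMonoid O] {T : SymmetricTensorCStarCategory.{u, v} O}

lemma arr_symm_natural (s t : T.Arr) :
    (arr (T.symm s.cod t.cod)).comp (s * t) = (t * s).comp (arr (T.symm s.dom t.dom)) := by
  change (arr _).comp (arr (T.tensor s.hom t.hom)) = (arr (T.tensor t.hom s.hom)).comp (arr _)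
  rw [← arr_comp, T.symm_natural, arr_comp]

lemma arr_symm_symm (a b : O) :
    (arr (T.symm b a)).comp (arr (T.symm a b)) = arr (T.id (a + b)) := by
  rw [← arr_comp, T.symm_symm]

lemma arr_symm_adj (a b : O) : (arr (T.symm a b)).adj = arr (T.symm b a) := by
  rw [← arr_adj, T.adj_symm]

@[simp] lemma arr_symm_zero (a : O) : arr (T.symm a 0) = arr (T.id a) := by
  rw [← T.symm_unit a, arr_homCast]

@[simp] lemma arr_symm_zero_left (a : O) : arr (T.symm 0 a) = arr (T.id a) := by
  rw [← arr_symm_adj, arr_symm_zero, Arr.adj_id]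

lemma arr_symm_add_left (a b c : O) : arr (T.symm (a + b) c) =
    (arr (T.symm a c) * arr (T.id b)).comp (arr (T.id a) * arr (T.symm b c)) := by
  rw [T.symm_hexagon]; simp

lemma arr_symm_add_right (a b c : O) : arr (T.symm a (b + c)) =
    (arr (T.id b) * arr (T.symm a c)).comp (arr (T.symm a b) * arr (T.id c)) := by
  rw [← arr_symm_adj, arr_symm_add_left, Arr.adj_comp, mul_adj, mul_adj, arr_symm_adj,
    arr_symm_adj, Arr.adj_id, Arr.adj_id]

/-- Naturality of the symmetry, in which `ε(ι, σ)` and `ε(ι, τ)` are identities. -/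
lemma arr_mul_comm_of_scalar (f : T.Hom 0 0) (t : T.Arr) : arr f * t = t * arr f := by
  have h := arr_symm_natural (arr f) t
  simpa [Arr.id_comp, Arr.comp_id] using h

end SymmetricTensorCStarCategory

/-! ### Conjugate equations and the invariance of `R^* ∘ R`. -/

namespace SymmetricTensorCStarCategory

open CStarCategory TensorCStarCategory

variable {O : Type u} [AddMonoid O] {T : SymmetricTensorCStarCategory.{u, v} O}

/-- The arrow `(1_τ ⊗ R'^*) ∘ (S ⊗ 1_σ) ∈ (σ, τ)`, where `R' = ε(σ, ρ) ∘ R`, that compares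
`R ∈ (ι, σ ρ)` with `S ∈ (ι, τ ρ)`. -/
noncomputable def comparison (σ τ ρ : O) (R S : T.Arr) : T.Arr :=
  (arr (T.id τ) * ((arr (T.symm σ ρ)).comp R).adj).comp (S * arr (T.id σ))

lemma comparison_dom {σ τ ρ : O} {R S : T.Arr} (hS : S.dom = 0) :
    (comparison σ τ ρ R S).dom = σ := by
  simp [comparison, hS]

lemma comparison_cod {σ τ ρ : O} {R S : T.Arr} (hR : R.dom = 0) :
    (comparison σ τ ρ R S).cod = τ := by
  simp [comparison, hR]

/-- Sliding `R` past `S` in `S ⊗ R` brings `R` next to `R'^*`, where the first conjugate equation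
straightens the zigzag and leaves `S`. -/
lemma comparison_mul_comp {σ τ ρ : O} {R S : T.Arr} (hR : R.dom = 0) (hS : S.dom = 0)
    (hR' : R.cod = σ + ρ) (hS' : S.cod = τ + ρ)
    (h : (((arr (T.symm σ ρ)).comp R).adj * arr (T.id ρ)).comp (arr (T.id ρ) * R) =
      arr (T.id ρ)) :
    (comparison σ τ ρ R S * arr (T.id ρ)).comp R = S := by
  have h1 : comparison σ τ ρ R S * arr (T.id ρ) =
      (arr (T.id τ) * ((arr (T.symm σ ρ)).comp R).adj * arr (T.id ρ)).comp
        (S * arr (T.id σ) * arr (T.id ρ)) := by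
    rw [← comp_mul_comp (by simp [hS', add_assoc]) (by simp), Arr.id_comp (by simp)]
    rfl
  have h2 : (S * arr (T.id σ) * arr (T.id ρ)).comp R = S * R := by
    rw [mul_assoc, ← arr_id_add, mul_eq_comp_left hS hR']
    simp
  have h3 : S * R = (arr (T.id τ) * (arr (T.id ρ) * R)).comp S := by
    rw [← mul_assoc, ← arr_id_add, mul_eq_comp_right hS' hR]
    simp
  rw [h1, Arr.comp_assoc, h2, h3, ← Arr.comp_assoc, mul_assoc,
    ← comp_mul_comp (by simp) (by simp [hR', add_assoc]), h, Arr.id_comp (by simp), ← arr_id_add,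
    Arr.id_comp hS']

lemma mul_id_eq_symm_comp {R : T.Arr} {a : O} (hR : R.dom = 0) (b : O) (ha : R.cod = a) :
    arr (T.id b) * R = (arr (T.symm a b)).comp (R * arr (T.id b)) := by
  have h := arr_symm_natural R (arr (T.id b))
  subst ha
  rw [arr_cod] at h
  rw [h, arr_dom, hR, arr_symm_zero_left, Arr.comp_id (by simp [hR])]

/-- Moving `R` and `S^*` across identities by naturality leaves two composites of symmetries. By the
hexagon both are `(1_τ ⊗ ε(σ, ρ)) ∘ (ε(σ, τ) ⊗ 1_ρ) ∘ (1_σ ⊗ ε(ρ, τ))`. -/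
lemma comparison_adj {σ τ ρ : O} {R S : T.Arr} (hR : R.dom = 0) (hS : S.dom = 0)
    (hR' : R.cod = σ + ρ) (hS' : S.cod = τ + ρ) :
    (comparison σ τ ρ R S).adj = comparison τ σ ρ S R := by
  have h1 : arr (T.id τ) * (arr (T.symm σ ρ)).comp R =
      ((arr (T.id τ) * arr (T.symm σ ρ)).comp (arr (T.symm (σ + ρ) τ))).comp
        (R * arr (T.id τ)) := by
    rw [Arr.comp_assoc, ← mul_id_eq_symm_comp hR τ hR', ← comp_mul_comp (by simp) (by simp [hR']),
      Arr.id_comp (by simp)]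
  have h2 : arr (T.id σ) * ((arr (T.symm τ ρ)).comp S).adj =
      (S.adj * arr (T.id σ)).comp
        ((arr (T.symm σ (τ + ρ))).comp (arr (T.id σ) * arr (T.symm ρ τ))) := by
    have h3 := congrArg Arr.adj (mul_id_eq_symm_comp hS σ hS')
    rw [mul_adj, Arr.adj_comp, mul_adj, arr_symm_adj, Arr.adj_id] at h3
    rw [← Arr.comp_assoc, ← h3, ← comp_mul_comp (by simp) (by simp [hS']), Arr.id_comp (by simp),
      Arr.adj_comp, arr_symm_adj]
  have h4 : (arr (T.id τ) * arr (T.symm σ ρ)).comp (arr (T.symm (σ + ρ) τ)) =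
      (arr (T.symm σ (τ + ρ))).comp (arr (T.id σ) * arr (T.symm ρ τ)) := by
    rw [arr_symm_add_left, arr_symm_add_right, Arr.comp_assoc]
  unfold comparison
  rw [Arr.adj_comp, mul_adj, mul_adj, Arr.adj_id, Arr.adj_id, Arr.adj_adj, h1, h2, h4,
    Arr.comp_assoc, Arr.comp_assoc, Arr.comp_assoc]

/-- As `(X ⊗ 1) ∘ R = R`, a factor `X` composed on the left of `X` moves through `1 ⊗ R'^*` and is
absorbed by `R`. -/
lemma comparison_comp_self {σ ρ : O} {R : T.Arr} (hR : R.dom = 0) (hR' : R.cod = σ + ρ)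
    (h : (((arr (T.symm σ ρ)).comp R).adj * arr (T.id ρ)).comp (arr (T.id ρ) * R) =
      arr (T.id ρ)) :
    (comparison σ σ ρ R R).comp (comparison σ σ ρ R R) = comparison σ σ ρ R R := by
  set X := comparison σ σ ρ R R with hX
  have hd : X.dom = σ := comparison_dom hR
  have hc : X.cod = σ := comparison_cod hR
  have h1 := comparison_mul_comp hR hR hR' hR' h
  rw [← hX] at h1
  have hdef : X = (arr (T.id σ) * ((arr (T.symm σ ρ)).comp R).adj).comp (R * arr (T.id σ)) := rfl
  have h2 : R * arr (T.id σ) = (X * arr (T.id (ρ + σ))).comp (R * arr (T.id σ)) := by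
    conv_lhs => rw [← h1]
    rw [arr_id_add, ← mul_assoc, ← comp_mul_comp (by simp [hd, hR']) (by simp),
      Arr.id_comp (by simp)]
  have h3 : X.comp (arr (T.id σ) * ((arr (T.symm σ ρ)).comp R).adj) =
      (arr (T.id σ) * ((arr (T.symm σ ρ)).comp R).adj).comp (X * arr (T.id (ρ + σ))) := by
    rw [← comp_mul_comp (by simp [hc]) (by simp), Arr.id_comp hc, Arr.comp_id (by simp)]
    rw [mul_eq_comp_left (a := σ) (b := 0) hd (by simp [hR]), arr_id_zero, mul_one]
  conv_lhs => arg 2; rw [hdef]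
  rw [← Arr.comp_assoc, h3, Arr.comp_assoc, ← h2, ← hdef]

/-- Two solutions of the conjugate equations for `ρ` define the same dimension. -/
lemma adj_comp_self_eq_of_conjugate {σ τ ρ : O} {R S : T.Arr} (hR : R.dom = 0) (hS : S.dom = 0)
    (hR' : R.cod = σ + ρ) (hS' : S.cod = τ + ρ)
    (h : (((arr (T.symm σ ρ)).comp R).adj * arr (T.id ρ)).comp (arr (T.id ρ) * R) =
      arr (T.id ρ))
    (h' : (((arr (T.symm τ ρ)).comp S).adj * arr (T.id ρ)).comp (arr (T.id ρ) * S) =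
      arr (T.id ρ)) :
    R.adj.comp R = S.adj.comp S := by
  have h1 := comparison_mul_comp hR hS hR' hS' h
  have h2 := comparison_mul_comp hS hR hS' hR' h'
  rw [← comparison_adj hR hS hR' hS'] at h2
  -- Both sides become `S^* ∘ (X ⊗ 1) ∘ R`.
  conv_rhs => arg 2; rw [← h1]
  conv_lhs => arg 1; rw [← h2]
  rw [Arr.adj_comp, mul_adj, Arr.adj_id, Arr.adj_adj, Arr.comp_assoc]

end SymmetricTensorCStarCategory

/-! ### The antisymmetric projection and the action of transpositions and cycles. -/

namespace SymmetricTensorCStarCategory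

open CStarCategory TensorCStarCategory

variable {O : Type u} [AddMonoid O] {T : SymmetricTensorCStarCategory.{u, v} O}

/-- A permutation of `0, …, n` corresponds to the image `k` of `0` and to a permutation of
`1, …, n`. -/
def permEquiv (n : ℕ) : Equiv.Perm (Fin (n + 1)) ≃ Fin (n + 1) × Equiv.Perm (Fin n) where
  toFun p := (p 0, (Equiv.Perm.decomposeFin (Fin.cycleRange (p 0) * p)).2)
  invFun q := (Fin.cycleRange q.1)⁻¹ * Equiv.Perm.decomposeFin.symm (0, q.2)
  left_inv p := by
    have h (q : Equiv.Perm (Fin (n + 1))) (hq : q 0 = 0) :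
        Equiv.Perm.decomposeFin.symm (0, (Equiv.Perm.decomposeFin q).2) = q := by
      obtain ⟨⟨k, p⟩, rfl⟩ := Equiv.Perm.decomposeFin.symm.surjective q
      rw [Equiv.Perm.decomposeFin_symm_apply_zero] at hq
      rw [hq, Equiv.apply_symm_apply]
    dsimp only
    rw [h _ (by simp), inv_mul_cancel_left]
  right_inv q := by
    obtain ⟨k, p⟩ := q
    have h : ((Fin.cycleRange k)⁻¹ * Equiv.Perm.decomposeFin.symm (0, p)) 0 = k := by
      rw [Equiv.Perm.mul_apply, Equiv.Perm.decomposeFin_symm_apply_zero, Equiv.Perm.inv_eq_iff_eq,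
        Fin.cycleRange_self]
    simp only [h]
    simp

lemma sign_permEquiv_symm (n : ℕ) (k : Fin (n + 1)) (p : Equiv.Perm (Fin n)) :
    Equiv.Perm.sign ((permEquiv n).symm (k, p)) = (-1) ^ (k : ℕ) * Equiv.Perm.sign p := by
  change Equiv.Perm.sign ((Fin.cycleRange k)⁻¹ * Equiv.Perm.decomposeFin.symm (0, p)) = _
  rw [map_mul, Equiv.Perm.sign_inv, Fin.sign_cycleRange, Equiv.Perm.decomposeFin.symm_sign]
  simp

lemma permArrow_succ (ρ : O) (n : ℕ) (p : Equiv.Perm (Fin (n + 1))) :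
    T.permArrow ρ (n + 1) p = T.comp (T.cycleArrow ρ n (permEquiv n p).1)
      (homCast T.Hom (succ_nsmul' ρ n).symm (succ_nsmul' ρ n).symm
        (T.tensor (T.id ρ) (T.permArrow ρ n (permEquiv n p).2))) := rfl

/-- The sum over permutations factors through `permEquiv`, the cycle with `0 ↦ k` having sign
`(-1)^k`. This recursion makes induction on the tensor power possible. -/
lemma antisym_succ (ρ : O) (n : ℕ) :
    T.antisym ρ (n + 1) = ((n + 1 : ℂ)⁻¹) • ∑ k : Fin (n + 1), ((-1 : ℂ) ^ (k : ℕ)) •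
      T.comp (T.cycleArrow ρ n k)
        (homCast T.Hom (succ_nsmul' ρ n).symm (succ_nsmul' ρ n).symm
          (T.tensor (T.id ρ) (T.antisym ρ n))) := by
  let L : T.Hom (n • ρ) (n • ρ) →ₗ[ℂ] T.Hom ((n + 1) • ρ) ((n + 1) • ρ) :=
    { toFun t := homCast T.Hom (succ_nsmul' ρ n).symm (succ_nsmul' ρ n).symm (T.tensor (T.id ρ) t)
      map_add' s t := by rw [map_add, T.homCast_add]
      map_smul' c t := by rw [map_smul, T.homCast_smul]; rfl }
  change _ = ((n + 1 : ℂ)⁻¹) • ∑ k : Fin (n + 1), ((-1 : ℂ) ^ (k : ℕ)) •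
      T.comp (T.cycleArrow ρ n k) (L (T.antisym ρ n))
  unfold antisym
  rw [← (permEquiv n).symm.sum_comp, Fintype.sum_prod_type, Nat.factorial_succ]
  have h (k : Fin (n + 1)) (p : Equiv.Perm (Fin n)) :
      T.permArrow ρ (n + 1) ((permEquiv n).symm (k, p)) =
        T.comp (T.cycleArrow ρ n k) (L (T.permArrow ρ n p)) := by
    rw [permArrow_succ, Equiv.apply_symm_apply]
    rfl
  simp only [h, sign_permEquiv_symm, map_smul, map_sum, Finset.smul_sum, smul_smul]
  refine Finset.sum_congr rfl fun k _ => Finset.sum_congr rfl fun p _ => ?_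
  congr 1
  push_cast
  rw [mul_inv]
  ring

@[simp] lemma arr_cycleArrow (ρ : O) (n : ℕ) (k : Fin (n + 1)) : arr (T.cycleArrow ρ n k) =
    arr (T.symm ρ ((k : ℕ) • ρ)) * arr (T.id ((n - k : ℕ) • ρ)) := by
  simp [cycleArrow]

lemma arr_id_nsmul_add (ρ : O) (m n : ℕ) :
    arr (T.id ((m + n) • ρ)) = arr (T.id (m • ρ)) * arr (T.id (n • ρ)) := by
  rw [add_nsmul, arr_id_add]

/-- The symmetry exchanging the tensor factors of `ρ ^ (i + 2 + j)` in the positions `i`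
and `i + 1`. -/
def swapArr (T : SymmetricTensorCStarCategory.{u, v} O) (ρ : O) (i j : ℕ) : T.Arr :=
  arr (T.id (i • ρ)) * arr (T.symm ρ ρ) * arr (T.id (j • ρ))

lemma swapArr_dom (ρ : O) (i j : ℕ) : (swapArr T ρ i j).dom = (i + 2 + j) • ρ := by
  simp [swapArr, add_nsmul, two_nsmul]

lemma swapArr_cod (ρ : O) (i j : ℕ) : (swapArr T ρ i j).cod = (i + 2 + j) • ρ := by
  simp [swapArr, add_nsmul, two_nsmul]

lemma swapArr_add_right (ρ : O) (i j k : ℕ) :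
    swapArr T ρ i (j + k) = swapArr T ρ i j * arr (T.id (k • ρ)) := by
  simp [swapArr, arr_id_nsmul_add, mul_assoc]

lemma swapArr_add_left (ρ : O) (i j k : ℕ) :
    swapArr T ρ (i + k) j = arr (T.id (i • ρ)) * swapArr T ρ k j := by
  simp [swapArr, arr_id_nsmul_add, mul_assoc]

lemma swapArr_comp_self (ρ : O) (i j : ℕ) :
    (swapArr T ρ i j).comp (swapArr T ρ i j) = arr (T.id ((i + 2 + j) • ρ)) := by
  unfold swapArr
  rw [← comp_mul_comp (by simp) (by simp), ← comp_mul_comp (by simp) (by simp),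
    Arr.id_comp (by simp), Arr.id_comp (by simp), arr_symm_symm, arr_id_nsmul_add,
    arr_id_nsmul_add, two_nsmul]

/-- The hexagon `ε(ρ, ρ^(k+1)) = (1 ⊗ ε(ρ, ρ)) ∘ (ε(ρ, ρ^k) ⊗ 1)`. -/
lemma swapArr_comp_cycleArrow {ρ : O} {n : ℕ} {k k' : Fin (n + 1)} (h : (k' : ℕ) = k + 1) :
    (swapArr T ρ k (n - k')).comp (arr (T.cycleArrow ρ n k)) = arr (T.cycleArrow ρ n k') := by
  have hn : n - k = 1 + (n - k') := by omega
  rw [arr_cycleArrow, arr_cycleArrow, hn, arr_id_nsmul_add, one_nsmul, ← mul_assoc]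
  unfold swapArr
  rw [← comp_mul_comp (by simp [add_assoc]) (by simp), Arr.id_comp (by simp), ← arr_symm_add_right, h,
    succ_nsmul]

lemma swapArr_comp_cycleArrow' {ρ : O} {n : ℕ} {k k' : Fin (n + 1)} (h : (k' : ℕ) = k + 1) :
    (swapArr T ρ k (n - k')).comp (arr (T.cycleArrow ρ n k')) = arr (T.cycleArrow ρ n k) := by
  rw [← swapArr_comp_cycleArrow h, ← Arr.comp_assoc, swapArr_comp_self, Arr.id_comp]
  rw [arr_cod]
  congr 1
  omega

/-- The cycle moves only the positions up to `k ≤ i`, which are disjoint from `i + 1` and `i + 2`,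
so this is the interchange law. The index drops by one because the leading `ρ` is split off. -/
lemma swapArr_comp_cycleArrow_of_lt {ρ : O} {n i j : ℕ} {k : Fin (n + 1)} (h : (k : ℕ) < i + 1)
    (hn : i + 2 + j = n) :
    (swapArr T ρ (i + 1) j).comp (arr (T.cycleArrow ρ n k)) =
      (arr (T.cycleArrow ρ n k)).comp (arr (T.id ρ) * swapArr T ρ i j) := by
  obtain ⟨m, hm⟩ : ∃ m, i + 1 = (k : ℕ) + 1 + m := ⟨i - k, by omega⟩
  have hi : i = (k : ℕ) + m := by omega
  have hm' : n - (k : ℕ) = m + 2 + j := by omega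
  have hid : (arr (T.symm ρ ((k : ℕ) • ρ))).comp (arr (T.id ρ) * arr (T.id ((k : ℕ) • ρ))) =
      arr (T.symm ρ ((k : ℕ) • ρ)) := by
    rw [← arr_id_add, Arr.comp_id (by simp)]
  rw [arr_cycleArrow, hm, swapArr_add_left, hi, swapArr_add_left, ← mul_assoc,
    ← comp_mul_comp (by simp [succ_nsmul]) (by simp [swapArr_dom, hm']),
    ← comp_mul_comp (by simp) (by simp [swapArr_cod, hm']),
    Arr.id_comp (by simp [succ_nsmul]), Arr.comp_id (by simp [swapArr_dom, hm']),
    hid, Arr.id_comp (by simp [swapArr_cod, hm'])]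

/-- The transposition acts inside the block `ρ^k` that the cycle shifts one step to the left, so
this is naturality of the symmetry. -/
lemma swapArr_comp_cycleArrow_of_gt {ρ : O} {n i j : ℕ} {k : Fin (n + 1)} (h : i + 1 < k)
    (hn : i + 2 + (j + 1) = n + 1) :
    (swapArr T ρ i (j + 1)).comp (arr (T.cycleArrow ρ n k)) =
      (arr (T.cycleArrow ρ n k)).comp (arr (T.id ρ) * swapArr T ρ i j) := by
  obtain ⟨m, hm⟩ : ∃ m, (k : ℕ) = i + 2 + m := ⟨k - (i + 2), by omega⟩
  have hj : j = m + (n - (k : ℕ)) := by omega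
  have hj' : j + 1 = m + (1 + (n - (k : ℕ))) := by omega
  have hnat := arr_symm_natural (arr (T.id ρ)) (swapArr T ρ i m)
  rw [swapArr_dom, swapArr_cod, ← hm, arr_dom, arr_cod] at hnat
  rw [arr_cycleArrow, hj', swapArr_add_right, hj, swapArr_add_right, arr_id_nsmul_add, one_nsmul,
    ← mul_assoc, ← mul_assoc, ← comp_mul_comp (by simp [swapArr_dom, hm]) (by simp), ← hnat,
    ← comp_mul_comp (by simp [swapArr_cod, hm]) (by simp)]

/-- Adjacent transpositions act on the antisymmetric projection by `-1`. -/
lemma comp_antisym_of_swap {ρ : O} {n : ℕ} : ∀ {i j : ℕ}, i + 2 + j = n →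
    ∀ {s : T.Hom (n • ρ) (n • ρ)}, arr s = swapArr T ρ i j →
      T.comp s (T.antisym ρ n) = -T.antisym ρ n := by
  induction n with
  | zero => intro i j h; omega
  | succ n ih =>
    intro i j hn s hs
    set L : T.Hom ((n + 1) • ρ) ((n + 1) • ρ) :=
      homCast T.Hom (succ_nsmul' ρ n).symm (succ_nsmul' ρ n).symm
        (T.tensor (T.id ρ) (T.antisym ρ n)) with hL
    -- A transposition that passes through the cycle reaches `1 ⊗ P_n`, where the induction
    -- hypothesis gives the sign.
    have hcomm (i' j' : ℕ) (hn' : i' + 2 + j' = n) (k : Fin (n + 1))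
        (h : (swapArr T ρ i j).comp (arr (T.cycleArrow ρ n k)) =
          (arr (T.cycleArrow ρ n k)).comp (arr (T.id ρ) * swapArr T ρ i' j')) :
        T.comp s (T.comp (T.cycleArrow ρ n k) L) = -T.comp (T.cycleArrow ρ n k) L := by
      obtain ⟨s', hs'⟩ := exists_arr_eq (swapArr T ρ i' j') (a := n • ρ) (b := n • ρ)
        (by rw [swapArr_dom, hn']) (by rw [swapArr_cod, hn'])
      have h1 : T.comp s (T.comp (T.cycleArrow ρ n k) L) = T.comp (T.cycleArrow ρ n k)
          (homCast T.Hom (succ_nsmul' ρ n).symm (succ_nsmul' ρ n).symm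
            (T.tensor (T.id ρ) (T.comp s' (T.antisym ρ n)))) := by
        apply arr_injective
        rw [arr_comp, arr_comp, hs, ← Arr.comp_assoc, h, arr_comp, Arr.comp_assoc, hL, arr_homCast,
          arr_homCast, arr_tensor, arr_tensor, arr_comp, ← hs',
          ← comp_mul_comp (by simp) (by simp), Arr.id_comp (by simp)]
      have h2 : homCast T.Hom (succ_nsmul' ρ n).symm (succ_nsmul' ρ n).symm
          (T.tensor (T.id ρ) (-T.antisym ρ n)) = -L := by
        rw [← neg_one_smul ℂ, map_smul, T.homCast_smul, neg_one_smul]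
      rw [h1, ih hn' hs', h2, map_neg]
    let a : Fin (n + 1) := ⟨i, by omega⟩
    let b : Fin (n + 1) := ⟨i + 1, by omega⟩
    have hab : (b : ℕ) = a + 1 := rfl
    have hj : n - (b : ℕ) = j := by change n - (i + 1) = j; omega
    -- The terms at `i` and `i + 1` are exchanged, with coefficients of opposite sign; every other
    -- term changes sign by induction. Reindexing by the swap then negates the whole sum.
    have hterm (k : Fin (n + 1)) :
        ((-1 : ℂ) ^ (k : ℕ)) • T.comp s (T.comp (T.cycleArrow ρ n k) L) =
          -(((-1 : ℂ) ^ (Equiv.swap a b k : ℕ)) •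
            T.comp (T.cycleArrow ρ n (Equiv.swap a b k)) L) := by
      by_cases hka : k = a
      · have h1 : T.comp s (T.cycleArrow ρ n a) = T.cycleArrow ρ n b := by
          apply arr_injective
          rw [arr_comp, hs, ← swapArr_comp_cycleArrow hab, hj]
        rw [hka, Equiv.swap_apply_left, ← T.assoc, h1, hab, pow_succ, mul_neg_one, neg_smul,
          neg_neg]
      by_cases hkb : k = b
      · have h1 : T.comp s (T.cycleArrow ρ n b) = T.cycleArrow ρ n a := by
          apply arr_injective
          rw [arr_comp, hs, ← swapArr_comp_cycleArrow' hab, hj]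
        rw [hkb, Equiv.swap_apply_right, ← T.assoc, h1, hab, pow_succ, mul_neg_one, neg_smul]
      · rw [Equiv.swap_apply_of_ne_of_ne hka hkb, ← smul_neg]
        congr 1
        have hka' : (k : ℕ) ≠ i := fun h => hka (Fin.ext h)
        have hkb' : (k : ℕ) ≠ i + 1 := fun h => hkb (Fin.ext h)
        rcases lt_or_gt_of_ne hka' with h | h
        · obtain ⟨i, rfl⟩ : ∃ i', i = i' + 1 := ⟨i - 1, by omega⟩
          exact hcomm i j (by omega) k (swapArr_comp_cycleArrow_of_lt h (by omega))
        · obtain ⟨j, rfl⟩ : ∃ j', j = j' + 1 := ⟨j - 1, by have := k.2; omega⟩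
          exact hcomm i j (by omega) k (swapArr_comp_cycleArrow_of_gt (by omega) hn)
    rw [antisym_succ, map_smul, map_sum, ← smul_neg]
    congr 1
    simp only [map_smul]
    rw [Finset.sum_congr rfl fun k _ => hterm k, Finset.sum_neg_distrib,
      Equiv.sum_comp (Equiv.swap a b) fun k : Fin (n + 1) => ((-1 : ℂ) ^ (k : ℕ)) • T.comp (T.cycleArrow ρ n k) L]

/-- Cyclic permutations act on antisymmetric arrows by their signs. -/
lemma cycleArrow_comp_of_antisym {ρ : O} {n : ℕ} {V : T.Hom 0 ((n + 1) • ρ)}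
    (hV : T.comp (T.antisym ρ (n + 1)) V = V) (k : Fin (n + 1)) :
    T.comp (T.cycleArrow ρ n k) V = ((-1 : ℂ) ^ (k : ℕ)) • V := by
  obtain ⟨k, hk⟩ := k
  induction k with
  | zero =>
    have h : T.cycleArrow ρ n ⟨0, hk⟩ = T.id _ := by
      apply arr_injective
      rw [arr_cycleArrow]
      change arr (T.symm ρ (0 • ρ)) * arr (T.id ((n - 0) • ρ)) = _
      rw [zero_nsmul, arr_symm_zero, ← arr_id_add, Nat.sub_zero, ← succ_nsmul']
    rw [h, T.id_comp, pow_zero, one_smul]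
  | succ k ih =>
    have hk' : k < n + 1 := by omega
    obtain ⟨s, hs⟩ := exists_arr_eq (swapArr T ρ k (n - (k + 1))) (a := (n + 1) • ρ)
      (b := (n + 1) • ρ) (by rw [swapArr_dom]; congr 1; omega)
      (by rw [swapArr_cod]; congr 1; omega)
    have h1 : T.cycleArrow ρ n ⟨k + 1, hk⟩ = T.comp s (T.cycleArrow ρ n ⟨k, hk'⟩) := by
      apply arr_injective
      rw [arr_comp, hs]
      exact (swapArr_comp_cycleArrow (k := ⟨k, hk'⟩) (k' := ⟨k + 1, hk⟩) rfl).symm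
    have h2 : T.comp s V = -V := by
      conv_lhs => rw [← hV]
      rw [← T.assoc, comp_antisym_of_swap (by omega) hs, map_neg, LinearMap.neg_apply, hV]
    rw [h1, T.assoc, ih hk', map_smul, h2, pow_succ, mul_neg_one, neg_smul, smul_neg]

end SymmetricTensorCStarCategory

/-! ### Existence and uniqueness of the dimension. -/

namespace SymmetricTensorCStarCategory

open CStarCategory TensorCStarCategory

variable {O : Type u} [AddMonoid O] {T : SymmetricTensorCStarCategory.{u, v} O}

/-- The second conjugate equation holds with the comparison projection as unit. -/
lemma adj_mul_comparison_comp {σ ρ : O} {R : T.Arr} (hR : R.dom = 0) (hR' : R.cod = σ + ρ)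
    (h : (((arr (T.symm σ ρ)).comp R).adj * arr (T.id ρ)).comp (arr (T.id ρ) * R) =
      arr (T.id ρ)) :
    (R.adj * comparison σ σ ρ R R).comp
      (comparison σ σ ρ R R * (arr (T.symm σ ρ)).comp R) = comparison σ σ ρ R R := by
  have hadj := comparison_adj hR hR hR' hR'
  have hsq := comparison_comp_self hR hR' h
  set X := comparison σ σ ρ R R with hX
  have hd : X.dom = σ := comparison_dom hR
  have hc : X.cod = σ := comparison_cod hR
  have hdef : X = (arr (T.id σ) * ((arr (T.symm σ ρ)).comp R).adj).comp (R * arr (T.id σ)) := rfl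
  -- This is the adjoint of the claim: the left side factors as `X ∘ (1 ⊗ R'^*) ∘ (R ⊗ 1) ∘ X = X ∘
  -- X ∘ X`.
  have key : (X * ((arr (T.symm σ ρ)).comp R).adj).comp (R * X) = X := by
    rw [mul_eq_comp_left (s := X) (a := σ) (b := 0) hd (by simp [hR]), arr_id_zero, mul_one,
      mul_eq_comp_left (s := R) (a := 0) (b := σ) hR hc, arr_id_zero, one_mul, Arr.comp_assoc,
      ← Arr.comp_assoc _ _ X, ← hdef, hsq, hsq]
  have h2 := congrArg Arr.adj key
  rw [Arr.adj_comp, mul_adj, mul_adj, Arr.adj_adj, hadj] at h2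
  exact h2

/-- The longest cycle is `ε(ρ, ρ^n)` and acts by `(-1)^n`; its inverse `ε(ρ^n, ρ)` therefore acts by
the same sign. -/
lemma symm_comp_of_antisym {ρ : O} {n : ℕ} {V : T.Hom 0 ((n + 1) • ρ)}
    (hV : T.comp (T.antisym ρ (n + 1)) V = V) :
    T.comp (T.symm (n • ρ) ρ) (homCast T.Hom rfl (succ_nsmul ρ n) V) =
      ((-1 : ℂ) ^ n) • homCast T.Hom rfl (succ_nsmul' ρ n) V := by
  have h1 : T.comp (T.symm ρ (n • ρ)) (homCast T.Hom rfl (succ_nsmul' ρ n) V) =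
      ((-1 : ℂ) ^ n) • homCast T.Hom rfl (succ_nsmul ρ n) V := by
    rw [← T.homCast_smul]
    apply arr_injective
    have h2 := cycleArrow_comp_of_antisym hV (Fin.last n)
    rw [Fin.val_last] at h2
    rw [arr_homCast, ← h2, arr_comp, arr_comp, arr_cycleArrow, arr_homCast, Fin.val_last,
      Nat.sub_self, zero_nsmul, arr_id_zero, mul_one]
  have h3 := congrArg (T.comp (T.symm (n • ρ) ρ)) h1
  rw [← T.assoc, T.symm_symm, T.id_comp, map_smul] at h3
  rw [h3, smul_smul, ← mul_pow]
  simp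

lemma arr_contract {ρ : O} {d : ℕ} (V V' : T.Hom 0 (d • ρ)) :
    arr (T.contract V V') = ((arr V).adj * arr (T.id ρ)).comp (arr (T.id ρ) * arr V') := by
  simp [contract]

lemma IsSpecialObject.antisym_comp {ρ : O} {d : ℕ} {V : T.Hom 0 (d • ρ)}
    (h : T.IsSpecialObject ρ d V) : T.comp (T.antisym ρ d) V = V := by
  rw [← h.comp_adj_self, T.assoc, h.adj_comp_self, T.comp_id]

/-- A special object has the dimension `d` given by its determinant in `(ι, ρ^d)`. -/
theorem IsSpecialObject.hasDimension {ρ : O} {d : ℕ} {V : T.Hom 0 (d • ρ)}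
    (h : T.IsSpecialObject ρ d V) : T.HasDimension ρ d := by
  have hV := h.antisym_comp
  obtain ⟨n, rfl⟩ : ∃ n, d = n + 1 := ⟨d - 1, by have := h.pos; omega⟩
  -- `V` is an isometry, so `R = c • V` needs `c^2 = d` to have `R^* ∘ R = d`.
  set c : ℂ := ((√((n + 1 : ℕ) : ℝ) : ℝ) : ℂ) with hc
  have hcc : c * c = ((n + 1 : ℕ) : ℂ) := by
    rw [hc, ← Complex.ofReal_mul, Real.mul_self_sqrt (Nat.cast_nonneg _), Complex.ofReal_natCast]
  have hstar : (starRingEnd ℂ) c = c := Complex.conj_ofReal _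
  set W := homCast T.Hom rfl (succ_nsmul ρ n) V with hW
  set W' := homCast T.Hom rfl (succ_nsmul' ρ n) V with hW'
  have hsymm : T.comp (T.symm (n • ρ) ρ) (c • W) = ((-1 : ℂ) ^ n * c) • W' := by
    rw [map_smul, symm_comp_of_antisym hV, smul_smul, mul_comm]
  have hconj : T.comp (homCast T.Hom (add_assoc ρ (n • ρ) ρ) (zero_add ρ)
      (T.tensor (T.adj (T.comp (T.symm (n • ρ) ρ) (c • W))) (T.id ρ)))
      (homCast T.Hom (add_zero ρ) rfl (T.tensor (T.id ρ) (c • W))) = T.id ρ := by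
    have h1 : T.comp (homCast T.Hom (add_assoc ρ (n • ρ) ρ) (zero_add ρ)
        (T.tensor (T.adj W') (T.id ρ)))
        (homCast T.Hom (add_zero ρ) rfl (T.tensor (T.id ρ) W)) = T.contract V V := by
      apply arr_injective
      rw [arr_contract]
      simp [hW, hW']
    rw [hsymm, map_smulₛₗ, map_smul, map_smul, LinearMap.smul_apply, T.homCast_smul,
      T.homCast_smul, map_smul, map_smul, LinearMap.smul_apply, h1, h.contract_self, smul_smul,
      smul_smul, map_mul, map_pow, map_neg, map_one, hstar, Nat.add_sub_cancel]
    have h2 : c * ((-1 : ℂ) ^ n * c) * ((-1 : ℂ) ^ n * (((n + 1 : ℕ) : ℂ))⁻¹) = 1 := by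
      have h3 : (((n + 1 : ℕ) : ℂ)) ≠ 0 := Nat.cast_ne_zero.2 (Nat.succ_ne_zero n)
      have h4 : (-1 : ℂ) ^ n * (-1) ^ n = 1 := by rw [← mul_pow]; simp
      calc _ = (c * c) * (((n + 1 : ℕ) : ℂ))⁻¹ * ((-1 : ℂ) ^ n * (-1) ^ n) := by ring
        _ = 1 := by rw [hcc, mul_inv_cancel₀ h3, h4, one_mul]
    rw [h2, one_smul]
  have hconj' : (((arr (T.symm (n • ρ) ρ)).comp (arr (c • W))).adj * arr (T.id ρ)).comp
      (arr (T.id ρ) * arr (c • W)) = arr (T.id ρ) := by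
    simpa only [arr_comp, arr_homCast, arr_tensor, arr_adj] using congrArg arr hconj
  -- The comparison of `R` with itself is the projection onto the conjugate inside `ρ^n`.
  obtain ⟨E, hE⟩ := exists_arr_eq (comparison (n • ρ) (n • ρ) ρ (arr (c • W)) (arr (c • W)))
    (comparison_dom rfl) (comparison_cod rfl)
  refine ⟨n • ρ, E, c • W, _, ?_, ?_, ?_, rfl, hconj, ?_, ?_⟩ <;> apply arr_injective
  · rw [arr_adj, hE, comparison_adj rfl rfl rfl rfl]
  · rw [arr_comp, hE, comparison_comp_self rfl rfl hconj']
  · rw [arr_comp, arr_tensor, hE, comparison_mul_comp rfl rfl rfl rfl hconj']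
  · rw [arr_comp, arr_homCast, arr_homCast, arr_tensor, arr_tensor, hE, arr_comp, arr_adj,
      adj_mul_comparison_comp rfl rfl hconj']
  · have h1 : T.comp (T.adj W) W = T.comp (T.adj V) V := by
      apply arr_injective
      simp [hW]
    rw [T.adj.map_smulₛₗ c W, map_smul, map_smul, LinearMap.smul_apply, h1, h.adj_comp_self, smul_smul,
      hstar, hcc]

/-- The dimension of an object is unique if the unit object is simple. -/
theorem HasDimension.unique {ρ : O} {d d' : ℕ} (h0 : T.IsSimple 0) (h : T.HasDimension ρ d)
    (h' : T.HasDimension ρ d') : d = d' := by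
  obtain ⟨σ, E, R, _, -, -, -, rfl, h1, -, h2⟩ := h
  obtain ⟨σ', E', R', _, -, -, -, rfl, h1', -, h2'⟩ := h'
  have h3 := congrArg arr h1
  have h3' := congrArg arr h1'
  simp only [arr_comp, arr_homCast, arr_tensor, arr_adj] at h3 h3'
  have h4 := adj_comp_self_eq_of_conjugate (R := arr R) (S := arr R') rfl rfl rfl rfl h3 h3'
  have h5 : T.comp (T.adj R) R = T.comp (T.adj R') R' := by
    apply arr_injective
    simpa using h4
  rw [h2, h2'] at h5
  exact_mod_cast h0.1 (by rw [Algebra.algebraMap_eq_smul_one, Algebra.algebraMap_eq_smul_one]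
                          exact h5 : algebraMap ℂ (T.Hom 0 0) d = algebraMap ℂ (T.Hom 0 0) d')

end SymmetricTensorCStarCategory

/-! ### The base algebra and Gelfand theory. -/

namespace SymmetricTensorCStarCategory

open CStarCategory TensorCStarCategory

variable {O : Type u} [AddMonoid O] {T : SymmetricTensorCStarCategory.{u, v} O}

lemma unitTensor_eq_tensorUnit {a b : O} (f : T.Hom 0 0) (t : T.Hom a b) :
    T.unitTensor f t = T.tensorUnit t f := by
  apply arr_injective
  rw [arr_unitTensor, arr_tensorUnit, arr_mul_comm_of_scalar]

/-- Because of the symmetry, `C(X^ι)` is all of `(ι, ι)`. -/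
lemma mem_baseAlgebra (f : T.Hom 0 0) : f ∈ T.baseAlgebra :=
  fun _ => unitTensor_eq_tensorUnit f _

/-- The Eckmann–Hilton argument; with the symmetry it makes `(ι, ι)` commutative. -/
lemma arr_mul_eq_comp (f g : T.Hom 0 0) : arr f * arr g = (arr f).comp (arr g) := by
  rw [mul_eq_comp_left (s := arr f) (a := 0) (b := 0) rfl rfl]
  simp

lemma scalar_mul_comm (f g : T.Hom 0 0) : f * g = g * f := by
  apply arr_injective
  rw [T.mul_def, T.mul_def, arr_comp, arr_comp, ← arr_mul_eq_comp, ← arr_mul_eq_comp,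
    arr_mul_comm_of_scalar]

variable (T) in
/-- The base algebra of a symmetric tensor C*-category is a commutative C*-algebra. -/
noncomputable abbrev baseCStarAlgebra : CommCStarAlgebra T.baseAlgebra where
  __ := StarSubalgebra.cstarAlgebra T.baseAlgebra
    (h_closed := by
      convert isClosed_univ
      exact Set.eq_univ_of_forall mem_baseAlgebra)
  mul_comm f g := Subtype.ext (scalar_mul_comm _ _)

lemma base_ext {f g : T.baseAlgebra} (h : ∀ x : T.BaseSpace, x f = x g) : f = g := by
  let := T.baseCStarAlgebra
  exact (gelfandTransform_bijective T.baseAlgebra).1 (ContinuousMap.ext h)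

/-- A Urysohn function on the compact Hausdorff spectrum, carried back by the Gelfand isomorphism.
-/
lemma exists_base_eq_one {x : T.BaseSpace} {W : Set T.BaseSpace} (hW : W ∈ 𝓝 x) :
    ∃ f : T.baseAlgebra, x f = 1 ∧ ∀ y ∉ W, y f = 0 := by
  let := T.baseCStarAlgebra
  have : CompactSpace T.BaseSpace :=
    inferInstanceAs (CompactSpace (WeakDual.characterSpace ℂ T.baseAlgebra))
  have : T2Space T.BaseSpace :=
    inferInstanceAs (T2Space (WeakDual.characterSpace ℂ T.baseAlgebra))
  obtain ⟨g, hg0, hg1, -⟩ := exists_continuous_zero_one_of_isClosed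
    (s := (interior W)ᶜ) (t := {x}) isOpen_interior.isClosed_compl isClosed_singleton
    (by
      rw [Set.disjoint_singleton_right, Set.mem_compl_iff, not_not]
      exact mem_interior_iff_mem_nhds.2 hW)
  obtain ⟨f, hf⟩ := (gelfandTransform_bijective T.baseAlgebra).2
    ⟨fun y => ((g y : ℝ) : ℂ), Complex.continuous_ofReal.comp g.continuous⟩
  have hf' (y : T.BaseSpace) : y f = ((g y : ℝ) : ℂ) := congrArg (fun k => k y) hf
  refine ⟨f, ?_, fun y hy => ?_⟩
  · rw [hf', hg1 (Set.mem_singleton x)]; simp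
  · rw [hf', hg0 fun h => hy (interior_subset h)]; simp

/-- An ideal of the base algebra without common zeros is everything. -/
lemma base_ideal_eq_top (J : Ideal T.baseAlgebra)
    (h : ∀ x : T.BaseSpace, ∃ f ∈ J, x f ≠ 0) : J = ⊤ := by
  let := T.baseCStarAlgebra
  by_contra hJ
  -- A proper ideal lies in a maximal one, whose character is a common zero.
  obtain ⟨M, hM, hJM⟩ := Ideal.exists_le_maximal J hJ
  obtain ⟨f, hf, hxf⟩ := h (Ideal.toCharacterSpace M)
  exact hxf (Ideal.toCharacterSpace_apply_eq_zero_of_mem M (hJM hf))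

variable (T) in
/-- The bilinear map `(f, t) ↦ f ⊗ t`. -/
noncomputable def unitTensorHom (a b : O) : T.Hom 0 0 →ₗ[ℂ] T.Hom a b →ₗ[ℂ] T.Hom a b :=
  LinearMap.mk₂ ℂ T.unitTensor
    (fun f g t => by
      rw [unitTensor, map_add, LinearMap.add_apply, T.homCast_add]; rfl)
    (fun c f t => by
      rw [unitTensor, map_smul, LinearMap.smul_apply, T.homCast_smul]; rfl)
    (fun f s t => by rw [unitTensor, map_add, T.homCast_add]; rfl)
    (fun c f t => by rw [unitTensor, map_smul, T.homCast_smul]; rfl)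

lemma unitTensorHom_apply {a b : O} (f : T.Hom 0 0) (t : T.Hom a b) :
    T.unitTensorHom a b f t = T.unitTensor f t := rfl

lemma unitTensor_mul {a b : O} (f g : T.Hom 0 0) (t : T.Hom a b) :
    T.unitTensor (f * g) t = T.unitTensor f (T.unitTensor g t) := by
  apply arr_injective
  rw [T.mul_def, arr_unitTensor, arr_unitTensor, arr_unitTensor, arr_comp, ← arr_mul_eq_comp,
    mul_assoc]

lemma unitTensor_id {a b : O} (t : T.Hom a b) : T.unitTensor (T.id 0) t = t := by
  apply arr_injective; simp

lemma unitTensor_smul_id {a b : O} (c : ℂ) (t : T.Hom a b) :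
    T.unitTensor (c • T.id 0) t = c • t := by
  rw [← unitTensorHom_apply, map_smul, LinearMap.smul_apply, unitTensorHom_apply, unitTensor_id]

lemma unitTensor_id_right (f : T.Hom 0 0) : T.unitTensor f (T.id 0) = f := by
  apply arr_injective; simp

lemma unitTensor_comp {a b c : O} (f : T.Hom 0 0) (s : T.Hom b c) (t : T.Hom a b) :
    T.unitTensor f (T.comp s t) = T.comp (T.unitTensor f s) t := by
  apply arr_injective
  rw [arr_unitTensor, arr_comp, arr_comp, arr_unitTensor]
  conv_lhs => rw [← Arr.comp_id (t := arr f) (a := 0) rfl, comp_mul_comp rfl rfl,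
    arr_id_zero, one_mul]

lemma comp_unitTensor {a b c : O} (f : T.Hom 0 0) (s : T.Hom b c) (t : T.Hom a b) :
    T.comp s (T.unitTensor f t) = T.unitTensor f (T.comp s t) := by
  apply arr_injective
  rw [arr_comp, arr_unitTensor, arr_unitTensor, arr_comp]
  conv_rhs => rw [← Arr.id_comp (t := arr f) (a := 0) rfl, comp_mul_comp rfl rfl,
    arr_id_zero, one_mul]

/-! ### Evaluation in local charts and the passage from local to global. -/

namespace LocalChart

variable {F : SymmetricTensorCStarCategory.{u, w} O} {W : Set T.BaseSpace} (c : LocalChart T F W)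

/-- The value of an arrow of `T` at a point of `W` in a local chart. -/
noncomputable def eval {a b : O} (y : W) : T.Hom a b →ₗ[ℂ] F.Hom a b where
  toFun t := c.map (T.restrict W t) y
  map_add' s t := by rw [map_add, map_add]; rfl
  map_smul' z t := by rw [map_smul, map_smul]; rfl

lemma eval_id (y : W) (a : O) : c.eval y (T.id a) = F.id a := c.map_id a y

lemma eval_comp (y : W) {a b e : O} (s : T.Hom b e) (t : T.Hom a b) :
    c.eval y (T.comp s t) = F.comp (c.eval y s) (c.eval y t) := c.map_comp s t y

lemma eval_adj (y : W) {a b : O} (t : T.Hom a b) :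
    c.eval y (T.adj t) = F.adj (c.eval y t) := c.map_adj t y

lemma eval_tensor (y : W) {a b e f : O} (s : T.Hom a b) (t : T.Hom e f) :
    c.eval y (T.tensor s t) = F.tensor (c.eval y s) (c.eval y t) := c.map_tensor s t y

lemma eval_symm (y : W) (a b : O) : c.eval y (T.symm a b) = F.symm a b := c.map_symm a b y

lemma eval_homCast (y : W) {a b a' b' : O} (ha : a = a') (hb : b = b') (t : T.Hom a b) :
    c.eval y (homCast T.Hom ha hb t) = homCast F.Hom ha hb (c.eval y t) := by
  subst ha hb; rfl

lemma eval_unitTensor (y : W) {a b : O} (f : T.Hom 0 0) (t : T.Hom a b) :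
    c.eval y (T.unitTensor f t) = F.unitTensor (c.eval y f) (c.eval y t) := by
  rw [unitTensor, eval_homCast, eval_tensor]; rfl

/-- This is where the `C(W)`-linearity of the chart enters. -/
lemma eval_scalar (y : W) (f : T.baseAlgebra) :
    c.eval y (f : T.Hom 0 0) = (y : T.BaseSpace) f • F.id 0 := by
  have h := c.map_base f (T.id 0) y
  rw [unitTensor_id_right, c.map_id] at h
  exact h

lemma eval_permArrow (y : W) (ρ : O) (n : ℕ) (p : Equiv.Perm (Fin n)) :
    c.eval y (T.permArrow ρ n p) = F.permArrow ρ n p := by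
  induction n with
  | zero => exact c.eval_id y _
  | succ n ih =>
    rw [permArrow_succ, permArrow_succ, eval_comp, eval_homCast, eval_tensor, eval_id, ih,
      cycleArrow, eval_homCast, eval_tensor, eval_symm, eval_id]
    rfl

lemma eval_antisym (y : W) (ρ : O) (n : ℕ) : c.eval y (T.antisym ρ n) = F.antisym ρ n := by
  simp only [antisym, map_smul, map_sum, eval_permArrow]

lemma eval_contract (y : W) {ρ : O} {d : ℕ} (V V' : T.Hom 0 (d • ρ)) :
    c.eval y (T.contract V V') = F.contract (c.eval y V) (c.eval y V') := by
  simp only [contract, eval_comp, eval_homCast, eval_tensor, eval_id, eval_adj]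

/-- Surjectivity of the chart, applied to a constant section. -/
lemma exists_eval_eq {a b : O} (s : F.Hom a b) : ∃ t : T.Hom a b, ∀ y, c.eval y t = s := by
  obtain ⟨q, hq⟩ := c.map.surjective (ContinuousMap.const W s)
  obtain ⟨t, rfl⟩ := Submodule.mkQ_surjective _ q
  exact ⟨t, fun y => congrArg (fun k => k y) hq⟩

lemma mem_vanishing {a b : O} {t : T.Hom a b} (h : ∀ y, c.eval y t = 0) :
    t ∈ T.vanishing W a b := by
  have h1 : c.map (T.restrict W t) = 0 := ContinuousMap.ext h
  rw [LinearEquiv.map_eq_zero_iff] at h1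
  exact (Submodule.Quotient.mk_eq_zero _).1 h1

end LocalChart

/-- The generators are `g ⊗ t` with `g = 0` on `W`, and `f * g` vanishes at every point. -/
lemma unitTensor_eq_zero_of_mem_vanishing {W : Set T.BaseSpace} {a b : O} {t : T.Hom a b}
    (ht : t ∈ T.vanishing W a b) {f : T.baseAlgebra} (hf : ∀ y ∉ W, y f = 0) :
    T.unitTensor (f : T.Hom 0 0) t = 0 := by
  have hle : T.vanishing W a b ≤ LinearMap.ker (T.unitTensorHom a b (f : T.Hom 0 0)) := by
    refine Submodule.span_le.2 ?_
    rintro _ ⟨g, t, hg, rfl⟩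
    have hfg : f * g = 0 := base_ext fun y => by
      rw [map_mul, map_zero]
      by_cases hy : y ∈ W
      · rw [hg y hy, mul_zero]
      · rw [hf y hy, zero_mul]
    have hfg' : (f : T.Hom 0 0) * (g : T.Hom 0 0) = 0 := congrArg Subtype.val hfg
    change T.unitTensor _ (T.unitTensor _ _) = 0
    rw [← unitTensor_mul, hfg', ← unitTensorHom_apply, map_zero, LinearMap.zero_apply]
  exact hle ht

variable {F : SymmetricTensorCStarCategory.{u, w} O}

/-- An arrow that vanishes in all local charts is zero. -/
lemma IsLocallyTrivial.eq_of_eval_eq (h : IsLocallyTrivial T F) {a b : O} {s t : T.Hom a b}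
    (hst : ∀ (W : Set T.BaseSpace) (c : LocalChart T F W) (y : W), c.eval y s = c.eval y t) :
    s = t := by
  -- The annihilator of `s - t`: a bump function at each point lies in it, hence so does `1`.
  let J : Ideal T.baseAlgebra :=
    { carrier := {f | T.unitTensor (f : T.Hom 0 0) (s - t) = 0}
      add_mem' {f g} hf hg := by
        change T.unitTensorHom a b ((f : T.Hom 0 0) + g) (s - t) = 0
        rw [map_add, LinearMap.add_apply, unitTensorHom_apply, unitTensorHom_apply, hf.out, hg.out,
          add_zero]
      zero_mem' := by
        change T.unitTensorHom a b 0 (s - t) = 0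
        rw [map_zero, LinearMap.zero_apply]
      smul_mem' f g hg := by
        change T.unitTensor ((f : T.Hom 0 0) * g) (s - t) = 0
        rw [unitTensor_mul, hg.out, ← unitTensorHom_apply, map_zero] }
  have hJ : J = ⊤ := base_ideal_eq_top J fun x => by
    obtain ⟨W, hW, -, ⟨c⟩⟩ := h.2 x
    obtain ⟨f, hf1, hf0⟩ := exists_base_eq_one hW
    refine ⟨f, ?_, by rw [hf1]; exact one_ne_zero⟩
    exact unitTensor_eq_zero_of_mem_vanishing
      (c.mem_vanishing fun y => by rw [map_sub, hst W c y, sub_self]) hf0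
  have h1 : (1 : T.baseAlgebra) ∈ J := hJ ▸ Submodule.mem_top
  have h2 : T.unitTensor (T.id 0) (s - t) = 0 := h1
  rw [unitTensor_id] at h2
  exact sub_eq_zero.1 h2

lemma IsSimple.exists_eq_smul_id {f : F.Hom 0 0} (h : F.IsSimple 0) : ∃ c : ℂ, f = c • F.id 0 := by
  obtain ⟨c, rfl⟩ := h.2 f
  exact ⟨c, Algebra.algebraMap_eq_smul_one c⟩

/-- `V' = P ∘ V' = V ∘ (V^* ∘ V')`, and `V^* ∘ V'` is a scalar. -/
lemma IsSpecialObject.exists_eq_smul {ρ : O} {d : ℕ} {V V' : F.Hom 0 (d • ρ)} (h0 : F.IsSimple 0)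
    (h : F.IsSpecialObject ρ d V) (hV' : F.comp (F.antisym ρ d) V' = V') :
    ∃ c : ℂ, V' = c • V := by
  obtain ⟨c, hc⟩ := IsSimple.exists_eq_smul_id (f := F.comp (F.adj V) V') h0
  refine ⟨c, ?_⟩
  rw [← hV', ← h.comp_adj_self, F.assoc, hc, map_smul, F.comp_id]

lemma contract_smul_smul {ρ : O} {d : ℕ} (V V' : F.Hom 0 (d • ρ)) (z z' : ℂ) :
    F.contract (z • V) (z' • V') = (star z * z') • F.contract V V' := by
  rw [contract, F.adj.map_smulₛₗ z V, map_smul, LinearMap.smul_apply, F.homCast_smul, map_smul,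
    LinearMap.smul_apply, map_smul, F.homCast_smul, map_smul, smul_smul]
  rfl

lemma mem_antisymmetricArrows {ρ : O} {d : ℕ} {V : T.Hom 0 (d • ρ)} :
    V ∈ T.antisymmetricArrows ρ d ↔ T.comp (T.antisym ρ d) V = V :=
  eq_comm

/-! ### Antisymmetric arrows as a twisted special object. -/

section LocallyTrivial

variable {ρ : O} {d : ℕ} {V₀ : F.Hom 0 (d • ρ)}

lemma exists_eval_eq_smul (hT : IsLocallyTrivial T F) (h₀ : F.IsSpecialObject ρ d V₀)
    {V : T.Hom 0 (d • ρ)} (hV : V ∈ T.antisymmetricArrows ρ d) {W : Set T.BaseSpace}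
    (c : LocalChart T F W) (y : W) : ∃ z : ℂ, c.eval y V = z • V₀ := by
  refine h₀.exists_eq_smul hT.1 ?_
  rw [← c.eval_antisym y, ← c.eval_comp, mem_antisymmetricArrows.1 hV]

/-- In the fibre the antisymmetrizer is `V₀ ∘ V₀^*` with `V₀` isometric, so idempotence needs no
group algebra. -/
lemma antisym_comp_antisym (hT : IsLocallyTrivial T F) (h₀ : F.IsSpecialObject ρ d V₀) :
    T.comp (T.antisym ρ d) (T.antisym ρ d) = T.antisym ρ d := by
  refine hT.eq_of_eval_eq fun W c y => ?_
  rw [c.eval_comp, c.eval_antisym, ← h₀.comp_adj_self, ← F.assoc, h₀.comp_adj_self,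
    h₀.antisym_comp, h₀.comp_adj_self]

lemma contract_of_mem_antisymmetricArrows (hT : IsLocallyTrivial T F)
    (h₀ : F.IsSpecialObject ρ d V₀) {V V' : T.Hom 0 (d • ρ)}
    (hV : V ∈ T.antisymmetricArrows ρ d) (hV' : V' ∈ T.antisymmetricArrows ρ d) :
    T.contract V V' =
      ((-1 : ℂ) ^ (d - 1) * (d : ℂ)⁻¹) • T.unitTensor (T.comp (T.adj V) V') (T.id ρ) := by
  refine hT.eq_of_eval_eq fun W c y => ?_
  obtain ⟨z, hz⟩ := exists_eval_eq_smul hT h₀ hV c y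
  obtain ⟨z', hz'⟩ := exists_eval_eq_smul hT h₀ hV' c y
  rw [c.eval_contract, map_smul, c.eval_unitTensor, c.eval_comp, c.eval_adj, c.eval_id, hz, hz',
    contract_smul_smul, h₀.contract_self, F.adj.map_smulₛₗ z V₀, map_smul, map_smul,
    LinearMap.smul_apply, h₀.adj_comp_self, smul_smul, smul_smul, unitTensor_smul_id, smul_smul]
  congr 1
  rw [starRingEnd_apply]
  ring

/-- With fibre values `z • V₀` and `z' • V₀`, both sides are `conj z * z'` times `V₀ ∘ V₀^* = P`. -/
lemma comp_adj_of_mem_antisymmetricArrows (hT : IsLocallyTrivial T F)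
    (h₀ : F.IsSpecialObject ρ d V₀) {V V' : T.Hom 0 (d • ρ)}
    (hV : V ∈ T.antisymmetricArrows ρ d) (hV' : V' ∈ T.antisymmetricArrows ρ d) :
    T.comp V' (T.adj V) = T.unitTensor (T.comp (T.adj V) V') (T.antisym ρ d) := by
  refine hT.eq_of_eval_eq fun W c y => ?_
  obtain ⟨z, hz⟩ := exists_eval_eq_smul hT h₀ hV c y
  obtain ⟨z', hz'⟩ := exists_eval_eq_smul hT h₀ hV' c y
  rw [c.eval_unitTensor, c.eval_comp, c.eval_comp, c.eval_adj, c.eval_antisym, hz, hz',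
    F.adj.map_smulₛₗ z V₀, map_smul, map_smul, map_smul, LinearMap.smul_apply, map_smul,
    LinearMap.smul_apply, h₀.adj_comp_self, h₀.comp_adj_self, smul_smul, smul_smul,
    unitTensor_smul_id, mul_comm]

lemma unitTensor_mem_antisymmetricArrows {V : T.Hom 0 (d • ρ)}
    (hV : V ∈ T.antisymmetricArrows ρ d) (f : T.Hom 0 0) :
    T.unitTensor f V ∈ T.antisymmetricArrows ρ d := by
  rw [mem_antisymmetricArrows] at hV ⊢
  rw [comp_unitTensor, hV]

lemma isClosed_antisymmetricArrows (ρ : O) (d : ℕ) :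
    IsClosed (T.antisymmetricArrows ρ d : Set (T.Hom 0 (d • ρ))) := by
  have h : Continuous (T.comp (a := 0) (T.antisym ρ d)) :=
    AddMonoidHomClass.continuous_of_bound (T.comp (a := 0) (T.antisym ρ d)) ‖T.antisym ρ d‖
      fun V => T.norm_comp_le _ V
  exact isClosed_eq continuous_id h

variable (T) in
/-- The span of all `V' ∘ V^*` with antisymmetric `V, V' ∈ (ι, ρ^d)`. -/
noncomputable def rankOneSpan (ρ : O) (d : ℕ) : Submodule ℂ (T.Hom (d • ρ) (d • ρ)) :=
  Submodule.span ℂ {s | ∃ V ∈ T.antisymmetricArrows ρ d, ∃ V' ∈ T.antisymmetricArrows ρ d,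
    s = T.comp V' (T.adj V)}

lemma unitTensor_mem_rankOneSpan {s : T.Hom (d • ρ) (d • ρ)} (hs : s ∈ T.rankOneSpan ρ d)
    (f : T.Hom 0 0) : T.unitTensor f s ∈ T.rankOneSpan ρ d := by
  have hle : T.rankOneSpan ρ d ≤ (T.rankOneSpan ρ d).comap (T.unitTensorHom _ _ f) := by
    refine Submodule.span_le.2 ?_
    rintro _ ⟨V, hV, V', hV', rfl⟩
    change T.unitTensor f _ ∈ T.rankOneSpan ρ d
    rw [unitTensor_comp]
    exact Submodule.subset_span ⟨V, hV, _, unitTensor_mem_antisymmetricArrows hV' f, rfl⟩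
  exact hle hs

lemma unitTensor_antisym_mem_rankOneSpan (hT : IsLocallyTrivial T F)
    (h₀ : F.IsSpecialObject ρ d V₀) (f : T.Hom 0 0) :
    T.unitTensor f (T.antisym ρ d) ∈ T.rankOneSpan ρ d := by
  let J : Ideal T.baseAlgebra :=
    { carrier := {f | T.unitTensor (f : T.Hom 0 0) (T.antisym ρ d) ∈ T.rankOneSpan ρ d}
      add_mem' {f g} hf hg := by
        change T.unitTensorHom _ _ ((f : T.Hom 0 0) + g) (T.antisym ρ d) ∈ T.rankOneSpan ρ d
        rw [map_add]
        exact add_mem hf.out hg.out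
      zero_mem' := by
        change T.unitTensorHom _ _ 0 (T.antisym ρ d) ∈ T.rankOneSpan ρ d
        rw [map_zero]
        exact zero_mem _
      smul_mem' f g hg := by
        change T.unitTensor ((f : T.Hom 0 0) * g) (T.antisym ρ d) ∈ T.rankOneSpan ρ d
        rw [unitTensor_mul]
        exact unitTensor_mem_rankOneSpan hg.out _ }
  have hJ : J = ⊤ := base_ideal_eq_top J fun x => by
    obtain ⟨W, hW, -, ⟨c⟩⟩ := hT.2 x
    obtain ⟨f, hf1, hf0⟩ := exists_base_eq_one hW
    refine ⟨f, ?_, by rw [hf1]; exact one_ne_zero⟩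
    -- The lift `V₁` is antisymmetric only over `W`. Applying `P` makes it so globally and keeps its
    -- values on `W`.
    obtain ⟨V₁, hV₁⟩ := c.exists_eval_eq V₀
    set V := T.comp (T.antisym ρ d) V₁ with hVdef
    have hV : V ∈ T.antisymmetricArrows ρ d := by
      rw [mem_antisymmetricArrows, hVdef, ← T.assoc, antisym_comp_antisym hT h₀]
    have hVy (y : W) : c.eval y V = V₀ := by
      rw [hVdef, c.eval_comp, c.eval_antisym, hV₁, h₀.antisym_comp]
    let g : T.baseAlgebra := ⟨T.comp (T.adj V) V, mem_baseAlgebra _⟩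
    have hg (y : T.BaseSpace) (hy : y ∈ W) : y g = 1 := by
      have h1 := c.eval_scalar ⟨y, hy⟩ g
      have h2 : c.eval ⟨y, hy⟩ (g : T.Hom 0 0) = F.id 0 := by
        change c.eval ⟨y, hy⟩ (T.comp (T.adj V) V) = _
        rw [c.eval_comp, c.eval_adj, hVy, h₀.adj_comp_self]
      rw [h2] at h1
      refine hT.1.1 ?_
      rw [map_one, Algebra.algebraMap_eq_smul_one]
      exact h1.symm
    -- `g = V^* ∘ V` is `1` on `W` and `f` vanishes off `W`; hence `f ⊗ P = f ⊗ (V ∘ V^*)`.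
    have hfg : f * g = f := base_ext fun y => by
      rw [map_mul]
      by_cases hy : y ∈ W
      · rw [hg y hy, mul_one]
      · rw [hf0 y hy, zero_mul]
    change T.unitTensor (f : T.Hom 0 0) (T.antisym ρ d) ∈ T.rankOneSpan ρ d
    rw [← congrArg Subtype.val hfg]
    change T.unitTensor ((f : T.Hom 0 0) * T.comp (T.adj V) V) (T.antisym ρ d) ∈ T.rankOneSpan ρ d
    rw [unitTensor_mul, ← comp_adj_of_mem_antisymmetricArrows hT h₀ hV hV]
    exact unitTensor_mem_rankOneSpan (Submodule.subset_span ⟨V, hV, V, hV, rfl⟩) _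
  exact (hJ ▸ Submodule.mem_top : (⟨f, mem_baseAlgebra f⟩ : T.baseAlgebra) ∈ J)

/-- If the fibre of a locally trivial category has a special object, then the antisymmetric arrows
form a twisted special object. -/
theorem isTwistedSpecialObject_antisymmetricArrows (hT : IsLocallyTrivial T F)
    (h₀ : F.IsSpecialObject ρ d V₀) :
    T.IsTwistedSpecialObject ρ d (T.antisymmetricArrows ρ d) where
  pos := h₀.pos
  isClosed := isClosed_antisymmetricArrows ρ d
  unitTensor_eq V _ f := unitTensor_eq_tensorUnit f V
  unitTensor_mem _ hV f := unitTensor_mem_antisymmetricArrows hV f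
  contract_eq _ hV _ hV' := contract_of_mem_antisymmetricArrows hT h₀ hV hV'
  span_eq := by
    apply Set.Subset.antisymm
    · have hle : T.rankOneSpan ρ d ≤
          LinearMap.range ((T.unitTensorHom (d • ρ) (d • ρ)).flip (T.antisym ρ d)) := by
        refine Submodule.span_le.2 ?_
        rintro _ ⟨V, hV, V', hV', rfl⟩
        exact ⟨_, (comp_adj_of_mem_antisymmetricArrows hT h₀ hV hV').symm⟩
      exact hle
    · rintro _ ⟨f, rfl⟩
      exact unitTensor_antisym_mem_rankOneSpan hT h₀ f

end LocallyTrivial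

end SymmetricTensorCStarCategory

theorem mainTheorem8 {O : Type u} [AddMonoid O] (T : SymmetricTensorCStarCategory.{u, v} O)
    (F : SymmetricTensorCStarCategory.{u, w} O) (ρ : O)
    (h : SymmetricTensorCStarCategory.IsSpecialCategory T F ρ) :
    (∃ d : ℕ, F.HasDimension ρ d) ∧
      ∀ d : ℕ, F.HasDimension ρ d →
        T.IsTwistedSpecialObject ρ d (T.antisymmetricArrows ρ d) := by
  obtain ⟨d, V, hV⟩ := h.special
  refine ⟨⟨d, hV.hasDimension⟩, fun d' hd' => ?_⟩
  -- The given dimension of the fibre object is the integer for which it is special.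
  obtain rfl := hd'.unique h.locallyTrivial.1 hV.hasDimension
  exact SymmetricTensorCStarCategory.isTwistedSpecialObject_antisymmetricArrows
    h.locallyTrivial hV
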